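/- Let $(M,d)$ be a compact metric space, and let $\nu$ be a Borel probability on $M$ with $\operatorname{supp}\nu=M$ (an a priori probability). Let $\Omega=\Omega^+=M^{\mathbb N}$, with elements $|x_1,x_2,\dots)$, and $\Omega^-=M^{\mathbb N}$, with elements $(\dots,y_2,y_1|$, both with the metric $\sum_{i\ge1}2^{-i}d(x_i,y_i)$. Let $\sigma$ be the shift on $\Omega$. Identify $\Omega^-$ with $\Omega$ through $(\dots,y_2,y_1|\mapsto|y_1,y_2,\dots)$; through this identification the notions below are also used on $\Omega^-$. On $\hat\Omega=\Omega^-\times\Omega^+$ let $$\hat\sigma(\dots,y_2,y_1|x_1,x_2,\dots)=(\dots,y_2,y_1,x_1|x_2,x_3,\dots).$$ For a Lipschitz function $A:\Omega\to\mathbb R$ let $\mathcal L_{A,\nu}f(x)=\int e^{A(|a,x_1,x_2,\dots))}f(|a,x_1,x_2,\dots))\,d\nu(a)$. The $\nu$-equilibrium $\mu_A$ of $A$ is the Borel probability on $\Omega$ with $\mathcal L_{\bar A,\nu}^*\mu_A=\mu_A$, where $\bar A=A+\log h-\log (h\circ\sigma)-\log\lambda$, and $h>0$ is a continuous function with $\mathcal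 L_{A,\nu}h=\lambda h$ for a number $\lambda>0$. For a shift-invariant Borel probability $\eta$ on $\Omega$ let $h^\nu(\eta)=-\sup\int B\,d\eta$, where the supremum is over all Lipschitz $B:\Omega\to\mathbb R$ with $\int e^{B(|a,x_1,x_2,\dots))}d\nu(a)=1$ for all $x\in\Omega$, and let $P_\nu(A)=\sup_\eta\left(\int A\,d\eta+h^\nu(\eta)\right)$, where the supremum is over all shift-invariant Borel probabilities $\eta$. **Proposition.** Let $A:\Omega^+\to\mathbb R$ be Lipschitz, and let $W:\hat\Omega\to\mathbb R$ be a Lipschitz involution kernel for $A$: the function $$A^-:=A\circ\hat\sigma^{-1}+W\circ\hat\sigma^{-1}-W$$ (with $A$ regarded as a function on $\hat\Omega$ that depends only on $x\in\Omega^+$) depends only on $y\in\Omega^-$. Let $\mu_A$ be the $\nu$-equilibrium of $A$. Then there is a unique $\hat\sigma$-invariant Borel probability $\hat\mu_A$ on $\hat\Omega$ whose marginal on $\Omega^+$ is $\mu_A$, and its marginal $(\mu_A)^-$ on $\Omega^-$ is the $\nu$-equilibrium of $A^-$, that is $$(\mu_A)^-=\mu_{(A^-)},$$ the only probability with the property that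 defines $\mu_{(A^-)}$. Moreover $(\mu_A)^-$ is the unique shift-invariant probability that attains the supremum $P_\nu(A^-)$. -/

import Mathlib

open MeasureTheory

namespace TFCA

/-- One-sided sequences of symbols. `x : SymSeq M` stands for `|x₁, x₂, …)` in `Ω = Ω⁺`
with `x n` the symbol `x_{n+1}`, and also (through the conjugation `θ`) for
`(…, x₂, x₁|` in `Ω⁻`. It carries the product topology and the product (= Borel)
sigma-algebra. -/
abbrev SymSeq (M : Type*) : Type _ := ℕ → M

/-- The concatenation `|a, x₁, x₂, …)`; on `Ω⁻` it is `(…, y₂, y₁, a|`. -/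
def cons {M : Type*} (a : M) (x : SymSeq M) : SymSeq M
  | 0 => a
  | n + 1 => x n

/-- The one-sided shift `|x₁, x₂, x₃, …) ↦ |x₂, x₃, …)`; on `Ω⁻` it is
`(…, y₃, y₂, y₁| ↦ (…, y₃, y₂|`. -/
def shift {M : Type*} (x : SymSeq M) : SymSeq M := fun n => x (n + 1)

/-- The bilateral shift of `Ω⁻ × Ω⁺`,
`(…, y₂, y₁ | x₁, x₂, …) ↦ (…, y₂, y₁, x₁ | x₂, x₃, …)`, with its inverse
`(…, y₂, y₁ | x₁, x₂, …) ↦ (…, y₃, y₂ | y₁, x₁, x₂, …)`. -/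
def biShift (M : Type*) : SymSeq M × SymSeq M ≃ SymSeq M × SymSeq M where
  toFun p := (cons (p.2 0) p.1, shift p.2)
  invFun p := (shift p.1, cons (p.1 0) p.2)
  left_inv p := by
    refine Prod.ext rfl (funext fun n => ?_)
    cases n <;> rfl
  right_inv p := by
    refine Prod.ext (funext fun n => ?_) rfl
    cases n <;> rfl

/-- The distance `∑_{i ≥ 1} d(x_i, y_i) / 2^i` on the space of sequences. -/
noncomputable def seqDist {M : Type*} [MetricSpace M] (x y : SymSeq M) : ℝ :=
  ∑' i : ℕ, dist (x i) (y i) / 2 ^ (i + 1)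

/-- Lipschitz functions on `Ω` with respect to `seqDist`. -/
def IsLip {M : Type*} [MetricSpace M] (f : SymSeq M → ℝ) : Prop :=
  ∃ C : ℝ, ∀ x y, |f x - f y| ≤ C * seqDist x y

/-- Lipschitz functions on `Ω⁻ × Ω⁺` with respect to the sum of the two distances
(which is Lipschitz equivalent to their maximum). -/
def IsLip₂ {M : Type*} [MetricSpace M] (W : SymSeq M × SymSeq M → ℝ) : Prop :=
  ∃ C : ℝ, ∀ p q, |W p - W q| ≤ C * (seqDist p.1 q.1 + seqDist p.2 q.2)

/-- `W` is a Lipschitz involution kernel for `A`, and `Am : Ω⁻ → ℝ` is the resulting dual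
potential: `A⁻ = A ∘ σ̂⁻¹ + W ∘ σ̂⁻¹ - W`, where the left-hand side is a function of `y` only. -/
def IsInvolutionKernel {M : Type*} [MetricSpace M]
    (A : SymSeq M → ℝ) (W : SymSeq M × SymSeq M → ℝ) (Am : SymSeq M → ℝ) : Prop :=
  IsLip₂ W ∧ ∀ y x : SymSeq M,
    Am y = A ((biShift M).symm (y, x)).2 + W ((biShift M).symm (y, x)) - W (y, x)

/-- The Ruelle operator `L_{A,ν} f (x) = ∫ e^{A(a x)} f(a x) dν(a)`. -/
noncomputable def ruelleOp {M : Type*} [MeasurableSpace M] (ν : Measure M)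
    (A f : SymSeq M → ℝ) (x : SymSeq M) : ℝ :=
  ∫ a, Real.exp (A (cons a x)) * f (cons a x) ∂ν

/-- The potential `A + log h - log (h ∘ σ) - log ev`, which is `ν`-normalized when `h > 0`
is an eigenfunction of the Ruelle operator of `A` with eigenvalue `ev > 0`. -/
noncomputable def normalizedPotential {M : Type*} (A h : SymSeq M → ℝ) (ev : ℝ)
    (x : SymSeq M) : ℝ :=
  A x + Real.log (h x) - Real.log (h (shift x)) - Real.log ev

/-- `μ` is the probability `μ_A`, the `ν`-equilibrium of `A`: it is fixed by the dual of the
Ruelle operator of the normalized potential built from `A` with a positive continuous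
eigenfunction `h` and its positive eigenvalue `ev`. -/
def IsNuEquilibrium {M : Type*} [MetricSpace M] [MeasurableSpace M] (ν : Measure M)
    (A : SymSeq M → ℝ) (μ : Measure (SymSeq M)) : Prop :=
  IsProbabilityMeasure μ ∧ ∃ (ev : ℝ) (h : SymSeq M → ℝ),
    0 < ev ∧ Continuous h ∧ (∀ x, 0 < h x) ∧
    (∀ x, ruelleOp ν A h x = ev * h x) ∧
    ∀ f : SymSeq M → ℝ, Continuous f →
      ∫ x, ruelleOp ν (normalizedPotential A h ev) f x ∂μ = ∫ x, f x ∂μ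

/-- Shift-invariant probabilities on `Ω`. -/
def IsInvariantProb {M : Type*} [MeasurableSpace M] (μ : Measure (SymSeq M)) : Prop :=
  IsProbabilityMeasure μ ∧ μ.map shift = μ

/-- `B` is a Lipschitz `ν`-normalized function: `∫ e^{B(a x)} dν(a) = 1` for all `x`. -/
def IsNormalized {M : Type*} [MetricSpace M] [MeasurableSpace M] (ν : Measure M)
    (B : SymSeq M → ℝ) : Prop :=
  IsLip B ∧ ∀ x, ∫ a, Real.exp (B (cons a x)) ∂ν = 1

/-- The relative entropy `h^ν(μ) = - sup {∫ B dμ | B Lipschitz and ν-normalized}`,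
with values in `[-∞, 0]`. -/
noncomputable def relEntropy {M : Type*} [MetricSpace M] [MeasurableSpace M] (ν : Measure M)
    (μ : Measure (SymSeq M)) : EReal :=
  - ⨆ (B : SymSeq M → ℝ) (_ : IsNormalized ν B), ((∫ x, B x ∂μ : ℝ) : EReal)

/-- The pressure `P_ν(A) = sup {∫ A dη + h^ν(η) | η a shift-invariant probability}`. -/
noncomputable def pressure {M : Type*} [MetricSpace M] [MeasurableSpace M] (ν : Measure M)
    (A : SymSeq M → ℝ) : EReal :=
  ⨆ (η : Measure (SymSeq M)) (_ : IsInvariantProb η),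
    ((∫ x, A x ∂η : ℝ) : EReal) + relEntropy ν η

/-- `μ` is a shift-invariant probability that attains the pressure of `A`. -/
def AttainsPressure {M : Type*} [MetricSpace M] [MeasurableSpace M] (ν : Measure M)
    (A : SymSeq M → ℝ) (μ : Measure (SymSeq M)) : Prop :=
  IsInvariantProb μ ∧ ((∫ x, A x ∂μ : ℝ) : EReal) + relEntropy ν μ = pressure ν A

/-- `μhat` is a probability on `Ω⁻ × Ω⁺`, invariant under the bilateral shift, which
extends the probability `μ` on `Ω⁺`. -/
def IsInvariantExtension {M : Type*} [MeasurableSpace M] (μ : Measure (SymSeq M))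
    (μhat : Measure (SymSeq M × SymSeq M)) : Prop :=
  IsProbabilityMeasure μhat ∧ μhat.map (biShift M) = μhat ∧ μhat.map Prod.snd = μ

end TFCA

open TFCA

/-! For a normalized `B`, the iterates of `ruelleOp ν B` make the oscillation of a Lipschitz
function decay exponentially (`IsNormalized.exists_oscillation_bound`). Hence the dual operator has
exactly one fixed probability (`IsNormalized.exists_isFixed`, `IsNormalized.isFixed_unique`), and
Lipschitz fixed functions are constant. Positive continuous eigenfunctions of a Lipschitz potential
are log-Lipschitz, hence unique up to a factor (`IsEigenpair.unique`), so the normalized potential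
does not depend on their choice. The equilibrium is thus the fixed probability of a single operator,
and it is also the only measure that attains the pressure (`IsEigenpair.attainsPressure_iff`).

The kernel enters through `A⁻(ya) + W(ya, x) = A(ax) + W(y, ax)`, where `ya` is `cons a y` read in
`Ω⁻`. By it, `h'(y) = ∫ e^{W(y,x)} / h(x) dμ(x)` is an eigenfunction of `A⁻` with the eigenvalue of
`A` (`IsInvolutionKernel.isEigenpair`). If `ρ` is the fixed probability of the normalized `A⁻`, then
`e^W / (h h') dρ dμ` is invariant under the bilateral shift and has marginals `ρ` and `μ`
(`isInvariantExtension_withDensity`). Iterating the shift forgets the past, so `μ` has only one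
invariant extension (`IsInvariantExtension.unique`): it is this measure, and `ρ` is its marginal on
`Ω⁻`. -/

namespace TFCA

/-! ### The distance `seqDist` and its relation to the product topology. -/

section Distance

@[simp] lemma cons_zero {M : Type*} (a : M) (x : SymSeq M) : cons a x 0 = a := rfl

@[simp] lemma cons_succ {M : Type*} (a : M) (x : SymSeq M) (n : ℕ) :
    cons a x (n + 1) = x n := rfl

@[simp] lemma shift_cons {M : Type*} (a : M) (x : SymSeq M) : shift (cons a x) = x := rfl

variable {M : Type*} [MetricSpace M]

lemma continuous_cons : Continuous fun p : M × SymSeq M => cons p.1 p.2 := by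
  refine continuous_pi fun n => ?_
  cases n with
  | zero => exact continuous_fst
  | succ n => exact (continuous_apply n).comp continuous_snd

lemma continuous_cons_left (x : SymSeq M) : Continuous fun a : M => cons a x :=
  continuous_cons.comp (continuous_id.prodMk continuous_const)

lemma continuous_cons_swap : Continuous fun p : SymSeq M × M => cons p.2 p.1 :=
  continuous_cons.comp continuous_swap

lemma continuous_shift : Continuous (shift : SymSeq M → SymSeq M) :=
  continuous_pi fun n => continuous_apply (n + 1)

lemma seqDist_nonneg (x y : SymSeq M) : 0 ≤ seqDist x y :=
  tsum_nonneg fun _ => by positivity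

lemma seqDist_comm (x y : SymSeq M) : seqDist x y = seqDist y x := by
  simp only [seqDist, dist_comm]

@[simp] lemma seqDist_self (x : SymSeq M) : seqDist x x = 0 := by
  simp [seqDist]

variable [CompactSpace M]

lemma dist_div_pow_le (x y : SymSeq M) (i : ℕ) :
    dist (x i) (y i) / 2 ^ (i + 1) ≤ Metric.diam (Set.univ : Set M) / 2 / 2 ^ i := by
  rw [div_div, ← pow_succ']
  gcongr
  exact Metric.dist_le_diam_of_mem isCompact_univ.isBounded trivial trivial

lemma summable_seqDist (x y : SymSeq M) :
    Summable fun i : ℕ => dist (x i) (y i) / 2 ^ (i + 1) :=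
  Summable.of_nonneg_of_le (fun _ => by positivity) (dist_div_pow_le x y)
    (summable_geometric_two' _)

lemma seqDist_le_diam (x y : SymSeq M) : seqDist x y ≤ Metric.diam (Set.univ : Set M) := by
  rw [← tsum_geometric_two' (Metric.diam (Set.univ : Set M))]
  exact (summable_seqDist x y).tsum_le_tsum (dist_div_pow_le x y) (summable_geometric_two' _)

lemma continuous_seqDist : Continuous fun p : SymSeq M × SymSeq M => seqDist p.1 p.2 := by
  refine continuous_tsum (fun i => ?_) (summable_geometric_two' (Metric.diam (Set.univ : Set M)))
    fun i p => ?_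
  · fun_prop
  · rw [Real.norm_of_nonneg (by positivity)]
    exact dist_div_pow_le p.1 p.2 i

lemma eq_of_seqDist_eq_zero {x y : SymSeq M} (h : seqDist x y = 0) : x = y := by
  have h1 := (summable_seqDist x y).hasSum
  rw [show (∑' i : ℕ, dist (x i) (y i) / 2 ^ (i + 1)) = 0 from h,
    hasSum_zero_iff_of_nonneg fun _ => by positivity] at h1
  funext i
  have := congrFun h1 i
  simpa using this

/-- The common head contributes nothing and every other weight is halved. This factor `1/2` is the
source of all contraction below. -/
lemma seqDist_cons (a : M) (x y : SymSeq M) :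
    seqDist (cons a x) (cons a y) = seqDist x y / 2 := by
  rw [seqDist, (summable_seqDist _ _).tsum_eq_zero_add, seqDist, ← tsum_div_const]
  simp only [cons_zero, dist_self, zero_div, zero_add, cons_succ]
  exact tsum_congr fun i => by rw [pow_succ _ (i + 1), div_div]

lemma dist_head_le (x y : SymSeq M) : dist (x 0) (y 0) ≤ 2 * seqDist x y := by
  have := (summable_seqDist x y).le_tsum 0 fun _ _ => by positivity
  simp only [zero_add, pow_one] at this
  change _ ≤ seqDist x y at this
  linarith

lemma seqDist_shift_le (x y : SymSeq M) : seqDist (shift x) (shift y) ≤ 2 * seqDist x y := by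
  have h : seqDist x y = dist (x 0) (y 0) / 2 + seqDist (shift x) (shift y) / 2 := by
    rw [seqDist, (summable_seqDist x y).tsum_eq_zero_add, seqDist, ← tsum_div_const]
    simp only [zero_add, pow_one, shift]
    congr 1
    exact tsum_congr fun i => by rw [pow_succ _ (i + 1), div_div]
  have := dist_nonneg (x := x 0) (y := y 0)
  linarith

lemma seqDist_cons_le (x y z w : SymSeq M) :
    seqDist (cons (z 0) x) (cons (w 0) y) ≤ seqDist z w + seqDist x y / 2 := by
  have h : seqDist (cons (z 0) x) (cons (w 0) y) = dist (z 0) (w 0) / 2 + seqDist x y / 2 := by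
    rw [seqDist, (summable_seqDist _ _).tsum_eq_zero_add]
    congr 1
    · simp
    · rw [seqDist, ← tsum_div_const]
      exact tsum_congr fun i => by simp [pow_succ _ (i + 1), div_div]
  have := dist_head_le z w
  linarith

/-- Continuous functions on the compact space of sequences are uniformly continuous with respect
to `seqDist`. -/
lemma exists_abs_sub_lt_of_seqDist_lt {f : SymSeq M → ℝ} (hf : Continuous f) {ε : ℝ}
    (hε : 0 < ε) : ∃ r > 0, ∀ x y, seqDist x y < r → |f x - f y| < ε := by
  -- By compactness `seqDist` attains a minimum on `S`, positive because points at distance zero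
  -- coincide; this minimum serves as `r`.
  let S : Set (SymSeq M × SymSeq M) := {p | ε ≤ |f p.1 - f p.2|}
  have hS : IsCompact S := (isClosed_le continuous_const (by fun_prop)).isCompact
  rcases S.eq_empty_or_nonempty with h | h
  · refine ⟨1, one_pos, fun x y _ => ?_⟩
    by_contra! hc
    exact (Set.eq_empty_iff_forall_notMem.mp h (x, y)) hc
  · obtain ⟨p, hp, hmin⟩ := hS.exists_isMinOn h continuous_seqDist.continuousOn
    refine ⟨seqDist p.1 p.2, ?_, fun x y hxy => ?_⟩
    · refine lt_of_le_of_ne (seqDist_nonneg _ _) fun h0 => ?_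
      have : ε ≤ |f p.1 - f p.2| := hp
      rw [eq_of_seqDist_eq_zero h0.symm, sub_self, abs_zero] at this
      linarith
    · by_contra! hc
      exact absurd (hmin (show (x, y) ∈ S from hc)) (not_le.mpr hxy)

end Distance

/-! ### Lipschitz functions and their density. -/

section Lipschitz

variable {M : Type*} [MetricSpace M]

lemma IsLip.exists_nonneg {f : SymSeq M → ℝ} (hf : IsLip f) :
    ∃ C : ℝ, 0 ≤ C ∧ ∀ x y, |f x - f y| ≤ C * seqDist x y := by
  obtain ⟨C, hC⟩ := hf
  exact ⟨max C 0, le_max_right _ _, fun x y => (hC x y).trans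
    (mul_le_mul_of_nonneg_right (le_max_left _ _) (seqDist_nonneg x y))⟩

lemma IsLip.add {f g : SymSeq M → ℝ} (hf : IsLip f) (hg : IsLip g) :
    IsLip fun x => f x + g x := by
  obtain ⟨C, hC⟩ := hf
  obtain ⟨D, hD⟩ := hg
  refine ⟨C + D, fun x y => ?_⟩
  calc |f x + g x - (f y + g y)| = |(f x - f y) + (g x - g y)| := by ring_nf
    _ ≤ |f x - f y| + |g x - g y| := abs_add_le _ _
    _ ≤ (C + D) * seqDist x y := by linarith [hC x y, hD x y]

lemma IsLip.const_mul {f : SymSeq M → ℝ} (hf : IsLip f) (c : ℝ) : IsLip fun x => c * f x := by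
  obtain ⟨C, hC⟩ := hf
  refine ⟨|c| * C, fun x y => ?_⟩
  rw [← mul_sub, abs_mul, mul_assoc]
  exact mul_le_mul_of_nonneg_left (hC x y) (abs_nonneg c)

lemma IsLip.neg {f : SymSeq M → ℝ} (hf : IsLip f) : IsLip fun x => -f x := by
  simpa using hf.const_mul (-1)

lemma IsLip.sub {f g : SymSeq M → ℝ} (hf : IsLip f) (hg : IsLip g) :
    IsLip fun x => f x - g x := by
  simpa [sub_eq_add_neg] using hf.add hg.neg

lemma isLip_const (c : ℝ) : IsLip fun _ : SymSeq M => c :=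
  ⟨0, fun x y => by simp⟩

variable [CompactSpace M]

lemma IsLip.comp_shift {f : SymSeq M → ℝ} (hf : IsLip f) : IsLip fun x => f (shift x) := by
  obtain ⟨C, hC0, hC⟩ := hf.exists_nonneg
  refine ⟨C * 2, fun x y => (hC _ _).trans ?_⟩
  rw [mul_assoc]
  exact mul_le_mul_of_nonneg_left (seqDist_shift_le x y) hC0

lemma IsLip.continuous {f : SymSeq M → ℝ} (hf : IsLip f) : Continuous f := by
  obtain ⟨C, hC⟩ := hf
  refine continuous_iff_continuousAt.mpr fun y => ?_
  rw [ContinuousAt, tendsto_iff_dist_tendsto_zero]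
  have h : Filter.Tendsto (fun x => C * seqDist x y) (nhds y) (nhds 0) := by
    have h1 : Continuous fun x : SymSeq M => C * seqDist x y :=
      continuous_const.mul (continuous_seqDist.comp (continuous_id.prodMk continuous_const))
    simpa using h1.tendsto y
  exact squeeze_zero (fun _ => dist_nonneg) (fun x => hC x y) h

lemma exists_abs_le_of_continuous {X : Type*} [TopologicalSpace X] [CompactSpace X] {f : X → ℝ}
    (hf : Continuous f) : ∃ C, ∀ x, |f x| ≤ C := by
  obtain ⟨C, hC⟩ := isCompact_univ.exists_bound_of_continuousOn hf.continuousOn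
  exact ⟨C, fun x => hC x trivial⟩

lemma IsLip.mul {f g : SymSeq M → ℝ} (hf : IsLip f) (hg : IsLip g) :
    IsLip fun x => f x * g x := by
  obtain ⟨F, hF⟩ := exists_abs_le_of_continuous hf.continuous
  obtain ⟨G, hG⟩ := exists_abs_le_of_continuous hg.continuous
  obtain ⟨C, hC⟩ := hf
  obtain ⟨D, hD⟩ := hg
  refine ⟨F * D + G * C, fun x y => ?_⟩
  calc |f x * g x - f y * g y| = |f x * (g x - g y) + g y * (f x - f y)| := by ring_nf
    _ ≤ |f x| * |g x - g y| + |g y| * |f x - f y| := by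
      rw [← abs_mul, ← abs_mul]; exact abs_add_le _ _
    _ ≤ F * (D * seqDist x y) + G * (C * seqDist x y) :=
      add_le_add
        (mul_le_mul (hF x) (hD x y) (abs_nonneg _) ((abs_nonneg _).trans (hF x)))
        (mul_le_mul (hG y) (hC x y) (abs_nonneg _) ((abs_nonneg _).trans (hG y)))
    _ = _ := by ring

/-- The algebra of Lipschitz functions. -/
def lipSubalgebra (M : Type*) [MetricSpace M] [CompactSpace M] : Subalgebra ℝ C(SymSeq M, ℝ) where
  carrier := {f | IsLip f}
  mul_mem' hf hg := IsLip.mul hf hg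
  add_mem' hf hg := IsLip.add hf hg
  algebraMap_mem' c := isLip_const c

lemma isLip_dist_apply (z : M) (n : ℕ) : IsLip fun x : SymSeq M => dist (x n) z := by
  induction n with
  | zero =>
    refine ⟨2, fun x y => ?_⟩
    exact (abs_dist_sub_le _ _ _).trans (dist_head_le x y)
  | succ n ih => exact ih.comp_shift

lemma lipSubalgebra_separatesPoints : (lipSubalgebra M).SeparatesPoints := by
  intro x y hxy
  obtain ⟨n, hn⟩ := Function.ne_iff.mp hxy
  refine ⟨_, ⟨⟨fun w => dist (w n) (y n), (isLip_dist_apply (y n) n).continuous⟩,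
    isLip_dist_apply (y n) n, rfl⟩, ?_⟩
  simpa using hn

/-- Stone–Weierstrass for `lipSubalgebra`; it reduces identities between integrals of continuous
functions to Lipschitz ones. -/
lemma exists_isLip_near {f : SymSeq M → ℝ} (hf : Continuous f) {ε : ℝ} (hε : 0 < ε) :
    ∃ g : SymSeq M → ℝ, IsLip g ∧ ∀ x, |f x - g x| < ε := by
  obtain ⟨g, hg⟩ := ContinuousMap.exists_mem_subalgebra_near_continuous_of_separatesPoints
    (lipSubalgebra M) lipSubalgebra_separatesPoints f hf ε hε
  exact ⟨g, g.2, fun x => by rw [abs_sub_comm]; exact hg x⟩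

end Lipschitz

/-! ### Integration of continuous functions on compact spaces. -/

section Compact

variable {X : Type*} [TopologicalSpace X] [CompactSpace X] [MeasurableSpace X]
  [OpensMeasurableSpace X]

lemma integrable_of_continuous {μ : Measure X} [IsFiniteMeasure μ] {f : X → ℝ}
    (hf : Continuous f) : Integrable f μ :=
  hf.integrable_of_hasCompactSupport (HasCompactSupport.of_compactSpace f)

lemma integral_pos_of_continuous {μ : Measure X} [IsProbabilityMeasure μ] {f : X → ℝ}
    (hf : Continuous f) (hpos : ∀ x, 0 < f x) : 0 < ∫ x, f x ∂μ := by
  rw [integral_pos_iff_support_of_nonneg (fun x => (hpos x).le) (integrable_of_continuous hf)]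
  have : Function.support f = Set.univ := by
    ext x; simp [(hpos x).ne']
  simp [this]

lemma abs_integral_sub_le {μ : Measure X} [IsProbabilityMeasure μ] {f g : X → ℝ}
    (hf : Continuous f) (hg : Continuous g) {ε : ℝ} (h : ∀ x, |f x - g x| ≤ ε) :
    |∫ x, f x ∂μ - ∫ x, g x ∂μ| ≤ ε := by
  rw [← integral_sub (integrable_of_continuous hf) (integrable_of_continuous hg)]
  simpa using norm_integral_le_of_norm_le_const (μ := μ) (f := fun x => f x - g x)
    (Filter.Eventually.of_forall h)

lemma continuous_integral_of_continuous {Y : Type*} [TopologicalSpace Y] [CompactSpace Y]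
    [FirstCountableTopology Y] [T2Space Y] {μ : Measure X} [IsFiniteMeasure μ] {f : Y → X → ℝ}
    (hf : Continuous f.uncurry) : Continuous fun y => ∫ x, f y x ∂μ := by
  simpa using continuous_parametric_integral_of_continuous (μ := μ) hf isCompact_univ

omit [CompactSpace X] in
lemma integral_withDensity_ofReal {μ : Measure X} {g : X → ℝ} (hg : Continuous g)
    (hpos : ∀ x, 0 ≤ g x) (f : X → ℝ) :
    ∫ x, f x ∂μ.withDensity (fun x => ENNReal.ofReal (g x)) = ∫ x, g x * f x ∂μ := by
  rw [integral_withDensity_eq_integral_toReal_smul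
    hg.measurable.ennreal_ofReal (by simp)]
  simp [ENNReal.toReal_ofReal (hpos _)]

lemma isProbabilityMeasure_withDensity_ofReal {μ : Measure X} [IsFiniteMeasure μ] {g : X → ℝ}
    (hg : Continuous g) (hpos : ∀ x, 0 ≤ g x) (h1 : ∫ x, g x ∂μ = 1) :
    IsProbabilityMeasure (μ.withDensity fun x => ENNReal.ofReal (g x)) := by
  constructor
  rw [withDensity_apply _ MeasurableSet.univ, Measure.restrict_univ,
    ← ofReal_integral_eq_lintegral_ofReal (integrable_of_continuous hg)
      (Filter.Eventually.of_forall hpos), h1, ENNReal.ofReal_one]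

end Compact

/-! ### The cone of log-Lipschitz functions. -/

section LogLip

variable {M : Type*} [MetricSpace M]

/-- Positive functions whose logarithm is Lipschitz with constant `K`. -/
def LogLip (K : ℝ) (f : SymSeq M → ℝ) : Prop :=
  (∀ x, 0 < f x) ∧ ∀ x y, f x ≤ Real.exp (K * seqDist x y) * f y

lemma LogLip.mono {K K' : ℝ} {f : SymSeq M → ℝ} (hf : LogLip K f) (h : K ≤ K') :
    LogLip K' f := by
  refine ⟨hf.1, fun x y => (hf.2 x y).trans ?_⟩
  have := seqDist_nonneg x y
  exact mul_le_mul_of_nonneg_right (by gcongr) (hf.1 y).le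

lemma logLip_iff_log {K : ℝ} {f : SymSeq M → ℝ} (hf : ∀ x, 0 < f x) :
    LogLip K f ↔ ∀ x y, |Real.log (f x) - Real.log (f y)| ≤ K * seqDist x y := by
  have key : ∀ x y, f x ≤ Real.exp (K * seqDist x y) * f y ↔
      Real.log (f x) - Real.log (f y) ≤ K * seqDist x y := fun x y => by
    rw [← Real.log_le_log_iff (hf x) (mul_pos (Real.exp_pos _) (hf y)),
      Real.log_mul (Real.exp_pos _).ne' (hf y).ne', Real.log_exp, sub_le_iff_le_add]
  refine ⟨fun h x y => abs_sub_le_iff.mpr ⟨(key x y).mp (h.2 x y), ?_⟩, fun h => ⟨hf, fun x y =>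
    (key x y).mpr ((le_abs_self _).trans (h x y))⟩⟩
  rw [seqDist_comm]
  exact (key y x).mp (h.2 y x)

lemma LogLip.isLip_log {K : ℝ} {f : SymSeq M → ℝ} (hf : LogLip K f) :
    IsLip fun x => Real.log (f x) :=
  ⟨K, (logLip_iff_log hf.1).mp hf⟩

lemma logLip_exp {C : ℝ} {g : SymSeq M → ℝ} (hg : ∀ x y, |g x - g y| ≤ C * seqDist x y) :
    LogLip C fun x => Real.exp (g x) :=
  (logLip_iff_log fun _ => Real.exp_pos _).mpr fun x y => by simpa using hg x y

lemma LogLip.div {K K' : ℝ} {f g : SymSeq M → ℝ} (hf : LogLip K f) (hg : LogLip K' g) :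
    LogLip (K + K') fun x => f x / g x := by
  refine (logLip_iff_log fun x => div_pos (hf.1 x) (hg.1 x)).mpr fun x y => ?_
  rw [Real.log_div (hf.1 x).ne' (hg.1 x).ne', Real.log_div (hf.1 y).ne' (hg.1 y).ne']
  have h1 := (logLip_iff_log hf.1).mp hf x y
  have h2 := (logLip_iff_log hg.1).mp hg x y
  rw [abs_le] at *
  constructor <;> linarith

/-- Subtracting a constant worsens the log-Lipschitz constant, but only from `3K/4` to `K` if at
most a quarter of `F` is removed. With `u = e^{K d / 4}` this reduces to `u⁴ - 1 ≤ 4 (u⁴ - u³)` for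
`u ≥ 1`. -/
lemma LogLip.sub_const {K t : ℝ} {F : SymSeq M → ℝ} (hK : 0 ≤ K) (hF : LogLip (3 * K / 4) F)
    (ht : ∀ y, t ≤ F y / 4) : LogLip K fun x => F x - t := by
  refine ⟨fun x => by linarith [hF.1 x, ht x], fun x y => ?_⟩
  set u := Real.exp (K * seqDist x y / 4) with hu
  have hu1 : 1 ≤ u := Real.one_le_exp (by have := seqDist_nonneg x y; positivity)
  have h4 : Real.exp (K * seqDist x y) = u ^ 4 := by
    rw [hu, ← Real.exp_nat_mul]; congr 1; push_cast; ring
  have h3 : Real.exp (3 * K / 4 * seqDist x y) = u ^ 3 := by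
    rw [hu, ← Real.exp_nat_mul]; congr 1; push_cast; ring
  have h := hF.2 x y
  rw [h3] at h
  rw [h4]
  have hFy := hF.1 y
  have a1 : t * (u ^ 4 - 1) ≤ F y / 4 * (u ^ 4 - 1) :=
    mul_le_mul_of_nonneg_right (ht y) (by linarith [one_le_pow₀ hu1 (n := 4)])
  have a2 : (u ^ 4 - 1) / 4 ≤ u ^ 4 - u ^ 3 := by
    have e : u ^ 4 - u ^ 3 - (u ^ 4 - 1) / 4 = (u - 1) * (3 * u ^ 3 - u ^ 2 - u - 1) / 4 := by ring
    have p : 0 ≤ 3 * u ^ 3 - u ^ 2 - u - 1 := by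
      have e2 : 3 * u ^ 3 - u ^ 2 - u - 1 = (u - 1) * (3 * u ^ 2 + 2 * u + 1) := by ring
      rw [e2]
      exact mul_nonneg (by linarith) (by positivity)
    have : 0 ≤ (u - 1) * (3 * u ^ 3 - u ^ 2 - u - 1) / 4 :=
      div_nonneg (mul_nonneg (by linarith) p) (by norm_num)
    linarith
  have a3 := mul_le_mul_of_nonneg_left a2 hFy.le
  linarith

variable [CompactSpace M]

lemma LogLip.continuous {K : ℝ} {f : SymSeq M → ℝ} (hf : LogLip K f) : Continuous f := by
  have : f = fun x => Real.exp (Real.log (f x)) := funext fun x => (Real.exp_log (hf.1 x)).symm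
  rw [this]
  exact Real.continuous_exp.comp hf.isLip_log.continuous

/-- Once `g + c ≥ C / K`, the increment `C d` is at most `K d (g + c)`, and `1 + K d ≤ e^{K d}`. -/
lemma IsLip.exists_logLip_add {g : SymSeq M → ℝ} (hg : IsLip g) {K : ℝ} (hK : 0 < K) :
    ∃ c : ℝ, LogLip K fun x => g x + c := by
  obtain ⟨G, hG⟩ := exists_abs_le_of_continuous hg.continuous
  obtain ⟨C, hC0, hC⟩ := hg.exists_nonneg
  have hCK : 0 ≤ C / K := by positivity
  have hpos : ∀ x, C / K < g x + (G + C / K + 1) := fun x => by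
    linarith [(abs_le.mp (hG x)).1]
  refine ⟨G + C / K + 1, fun x => hCK.trans_lt (hpos x), fun x y => ?_⟩
  have hd := seqDist_nonneg x y
  have h1 := Real.add_one_le_exp (K * seqDist x y)
  have h2 := (abs_le.mp (hC x y)).2
  have h3 : K * seqDist x y * (C / K) ≤ K * seqDist x y * (g y + (G + C / K + 1)) :=
    mul_le_mul_of_nonneg_left (hpos y).le (by positivity)
  have h4 : K * seqDist x y * (C / K) = C * seqDist x y := by field_simp
  have h5 := mul_le_mul_of_nonneg_right h1 (hCK.trans_lt (hpos y)).le
  linarith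

end LogLip

/-! ### The Ruelle operator and the regularity of its eigenfunctions. -/

section Ruelle

variable {M : Type*} [MetricSpace M] [CompactSpace M] [MeasurableSpace M] [BorelSpace M]
  (ν : Measure M) [IsProbabilityMeasure ν]

variable {A : SymSeq M → ℝ}

lemma integrable_ruelle (hA : Continuous A) {f : SymSeq M → ℝ} (hf : Continuous f)
    (x : SymSeq M) : Integrable (fun a => Real.exp (A (cons a x)) * f (cons a x)) ν :=
  integrable_of_continuous (((Real.continuous_exp.comp hA).mul hf).comp (continuous_cons_left x))

lemma continuous_ruelleOp (hA : Continuous A) {f : SymSeq M → ℝ} (hf : Continuous f) :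
    Continuous (ruelleOp ν A f) := by
  refine continuous_integral_of_continuous
    (f := fun x a => Real.exp (A (cons a x)) * f (cons a x)) ?_
  have h : Continuous fun p : SymSeq M × M => cons p.2 p.1 :=
    continuous_cons.comp continuous_swap
  exact ((Real.continuous_exp.comp hA).mul hf).comp h

lemma continuous_ruelleOp_iterate (hA : Continuous A) {f : SymSeq M → ℝ} (hf : Continuous f)
    (n : ℕ) : Continuous ((ruelleOp ν A)^[n] f) := by
  induction n generalizing f with
  | zero => exact hf
  | succ n ih => exact ih (continuous_ruelleOp ν hA hf)

lemma ruelleOp_add (hA : Continuous A) {f g : SymSeq M → ℝ} (hf : Continuous f)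
    (hg : Continuous g) (x : SymSeq M) :
    ruelleOp ν A (fun z => f z + g z) x = ruelleOp ν A f x + ruelleOp ν A g x := by
  simp only [ruelleOp, mul_add]
  exact integral_add (integrable_ruelle ν hA hf x) (integrable_ruelle ν hA hg x)

omit [MetricSpace M] [CompactSpace M] [BorelSpace M] [IsProbabilityMeasure ν] in
lemma ruelleOp_const_mul (A : SymSeq M → ℝ) (f : SymSeq M → ℝ) (c : ℝ) (x : SymSeq M) :
    ruelleOp ν A (fun z => c * f z) x = c * ruelleOp ν A f x := by
  simp only [ruelleOp, ← integral_const_mul]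
  congr 1
  ext a
  ring

lemma ruelleOp_sub (hA : Continuous A) {f g : SymSeq M → ℝ} (hf : Continuous f)
    (hg : Continuous g) (x : SymSeq M) :
    ruelleOp ν A (fun z => f z - g z) x = ruelleOp ν A f x - ruelleOp ν A g x := by
  simp only [ruelleOp, mul_sub]
  exact integral_sub (integrable_ruelle ν hA hf x) (integrable_ruelle ν hA hg x)

lemma ruelleOp_mono (hA : Continuous A) {f g : SymSeq M → ℝ} (hf : Continuous f)
    (hg : Continuous g) (h : ∀ x, f x ≤ g x) (x : SymSeq M) :
    ruelleOp ν A f x ≤ ruelleOp ν A g x :=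
  integral_mono (integrable_ruelle ν hA hf x) (integrable_ruelle ν hA hg x) fun _ =>
    mul_le_mul_of_nonneg_left (h _) (Real.exp_pos _).le

lemma ruelleOp_pos (hA : Continuous A) {f : SymSeq M → ℝ} (hf : Continuous f)
    (h : ∀ x, 0 < f x) (x : SymSeq M) : 0 < ruelleOp ν A f x :=
  integral_pos_of_continuous
    (((Real.continuous_exp.comp hA).mul hf).comp (continuous_cons_left x))
    fun _ => mul_pos (Real.exp_pos _) (h _)

variable {C : ℝ}

/-- If `f x ≤ c e^{K d(x,y)} f y` holds for nearby points then the Ruelle operator improves the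
constant `K`, and doubles the range. -/
lemma ruelleOp_le_of_local (hA : Continuous A)
    (hC : ∀ x y, |A x - A y| ≤ C * seqDist x y) {f : SymSeq M → ℝ} (hf : Continuous f)
    (h0 : ∀ x, 0 < f x) {K c r : ℝ}
    (h : ∀ x y, seqDist x y < r → f x ≤ c * Real.exp (K * seqDist x y) * f y) (x y : SymSeq M)
    (hxy : seqDist x y < 2 * r) :
    ruelleOp ν A f x ≤ c * Real.exp ((C + K) / 2 * seqDist x y) * ruelleOp ν A f y := by
  simp only [ruelleOp]
  rw [← integral_const_mul]
  refine integral_mono (integrable_ruelle ν hA hf x)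
    ((integrable_ruelle ν hA hf y).const_mul _) fun a => ?_
  -- Prepending `a` halves the distance, so pairs at distance below `2r` fall in the range of `h`.
  have h1 := h (cons a x) (cons a y) (by rw [seqDist_cons]; linarith)
  have h2 := (abs_le.mp (hC (cons a x) (cons a y))).2
  rw [seqDist_cons] at h1 h2
  calc Real.exp (A (cons a x)) * f (cons a x)
      ≤ Real.exp (C * (seqDist x y / 2) + A (cons a y)) *
          (c * Real.exp (K * (seqDist x y / 2)) * f (cons a y)) := by
        refine mul_le_mul ?_ h1 (h0 _).le (Real.exp_pos _).le
        exact Real.exp_le_exp.mpr (by linarith)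
    _ = c * Real.exp ((C + K) / 2 * seqDist x y) *
          (Real.exp (A (cons a y)) * f (cons a y)) := by
        rw [Real.exp_add, show (C + K) / 2 * seqDist x y = C * (seqDist x y / 2) +
          K * (seqDist x y / 2) by ring, Real.exp_add]
        ring

lemma LogLip.ruelleOp (hC : ∀ x y, |A x - A y| ≤ C * seqDist x y) {K : ℝ} {f : SymSeq M → ℝ}
    (hf : LogLip K f) : LogLip ((C + K) / 2) (ruelleOp ν A f) := by
  have hA : Continuous A := IsLip.continuous ⟨C, hC⟩
  refine ⟨ruelleOp_pos ν hA hf.continuous hf.1, fun x y => ?_⟩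
  have := ruelleOp_le_of_local ν hA hC hf.continuous hf.1 (K := K) (c := 1)
    (r := seqDist x y + 1) (fun x y _ => by rw [one_mul]; exact hf.2 x y) x y
    (by linarith [seqDist_nonneg x y])
  rwa [one_mul] at this

/-- A positive continuous eigenfunction of the Ruelle operator of a Lipschitz potential is
log-Lipschitz. -/
lemma logLip_of_eigenfunction (hC0 : 0 ≤ C) (hC : ∀ x y, |A x - A y| ≤ C * seqDist x y)
    {h : SymSeq M → ℝ} (hc : Continuous h) (hpos : ∀ x, 0 < h x) {ev : ℝ} (hev : 0 < ev)
    (heig : ∀ x, TFCA.ruelleOp ν A h x = ev * h x) : LogLip C h := by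
  have hA : Continuous A := IsLip.continuous ⟨C, hC⟩
  have global : ∀ c : ℝ, 1 < c → ∀ x y, h x ≤ c * Real.exp (C * seqDist x y) * h y := by
    intro c hc1
    have hlog : Continuous fun x => Real.log (h x) := hc.log fun x => (hpos x).ne'
    obtain ⟨r, hr, hloc⟩ := exists_abs_sub_lt_of_seqDist_lt hlog (Real.log_pos hc1)
    -- Uniform continuity of `log h` gives the bound at scale `r`. Each use of the eigenvalue
    -- equation doubles the scale and keeps the exponent, since `(C + C) / 2 = C`, and keeps `c` as
    -- well.
    have step : ∀ n : ℕ, ∀ x y, seqDist x y < 2 ^ n * r →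
        h x ≤ c * Real.exp (C * seqDist x y) * h y := by
      intro n
      induction n with
      | zero =>
        intro x y hxy
        have h1 := (abs_lt.mp (hloc x y (by simpa using hxy))).2
        have h2 : h x ≤ c * h y := by
          rw [← Real.log_le_log_iff (hpos x) (mul_pos (by linarith) (hpos y)),
            Real.log_mul (by linarith) (hpos y).ne']
          linarith
        refine h2.trans (mul_le_mul_of_nonneg_right ?_ (hpos y).le)
        exact le_mul_of_one_le_right (by linarith)
          (Real.one_le_exp (mul_nonneg hC0 (seqDist_nonneg x y)))
      | succ n ih =>
        intro x y hxy
        have := ruelleOp_le_of_local ν hA hC hc hpos ih x y (by rw [pow_succ] at hxy; linarith)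
        rw [heig, heig, add_self_div_two] at this
        have h3 : ev * h x ≤ ev * (c * Real.exp (C * seqDist x y) * h y) := by linarith
        exact le_of_mul_le_mul_left h3 hev
    intro x y
    obtain ⟨n, hn⟩ := pow_unbounded_of_one_lt (seqDist x y / r) (one_lt_two (α := ℝ))
    exact step n x y ((div_lt_iff₀ hr).mp hn)
  refine ⟨hpos, fun x y => ?_⟩
  -- Let `c` decrease to `1`: each `b` above the target is the target times some `c > 1`.
  refine le_of_forall_gt_imp_ge_of_dense fun b hb => ?_
  have hp : 0 < Real.exp (C * seqDist x y) * h y := mul_pos (Real.exp_pos _) (hpos y)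
  have := global (b / (Real.exp (C * seqDist x y) * h y)) ((one_lt_div hp).mpr hb) x y
  rwa [mul_assoc, div_mul_cancel₀ _ hp.ne'] at this

end Ruelle

/-! ### Normalized potentials: contraction, and the unique fixed probability. -/

section Normalized

variable {M : Type*} [MetricSpace M] [CompactSpace M] [MeasurableSpace M] [BorelSpace M]
  {ν : Measure M} [IsProbabilityMeasure ν] {B : SymSeq M → ℝ}

omit [CompactSpace M] [BorelSpace M] [IsProbabilityMeasure ν] in
lemma IsNormalized.ruelleOp_const (hB : IsNormalized ν B) (c : ℝ) (x : SymSeq M) :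
    ruelleOp ν B (fun _ => c) x = c := by
  rw [ruelleOp, integral_mul_const, hB.2 x, one_mul]

omit [MetricSpace M] [CompactSpace M] [BorelSpace M] [IsProbabilityMeasure ν] in
lemma ruelleOp_mul_comp_shift (f g : SymSeq M → ℝ) (x : SymSeq M) :
    ruelleOp ν B (fun z => f z * g (shift z)) x = ruelleOp ν B f x * g x := by
  simp only [ruelleOp, shift_cons, ← integral_mul_const, mul_assoc]

lemma IsNormalized.iterate_add_const (hB : IsNormalized ν B) {f : SymSeq M → ℝ}
    (hf : Continuous f) (c : ℝ) (n : ℕ) (x : SymSeq M) :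
    (ruelleOp ν B)^[n] (fun z => f z + c) x = (ruelleOp ν B)^[n] f x + c := by
  induction n generalizing f with
  | zero => rfl
  | succ n ih =>
    have h : ruelleOp ν B (fun z => f z + c) = fun z => ruelleOp ν B f z + c :=
      funext fun z => by
        rw [ruelleOp_add ν hB.1.continuous hf continuous_const, hB.ruelleOp_const]
    rw [Function.iterate_succ_apply, Function.iterate_succ_apply, h,
      ih (continuous_ruelleOp ν hB.1.continuous hf)]

/-- Iterates of the Ruelle operator contract the oscillation of log-Lipschitz functions. -/
lemma IsNormalized.abs_iterate_sub_le (hB : IsNormalized ν B) {C K : ℝ} (hK : 0 ≤ K)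
    (hCK : C ≤ K / 2) (hC : ∀ x y, |B x - B y| ≤ C * seqDist x y) (n : ℕ)
    {f : SymSeq M → ℝ} {S : ℝ} (hf : LogLip K f) (hS : ∀ x, f x ≤ S) (x y : SymSeq M) :
    |(ruelleOp ν B)^[n] f x - (ruelleOp ν B)^[n] f y| ≤
      (1 - Real.exp (-(K * Metric.diam (Set.univ : Set M))) / 4) ^ n * S := by
  set e := Real.exp (-(K * Metric.diam (Set.univ : Set M))) with he
  have hBc := hB.1.continuous
  have he1 : e ≤ 1 := Real.exp_le_one_iff.mpr (by
    have := Metric.diam_nonneg (s := (Set.univ : Set M)); simp; positivity)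
  induction n generalizing f S x y with
  | zero =>
    have h1 := hf.1 x
    have h2 := hf.1 y
    have h3 := hS x
    have h4 := hS y
    simp only [Function.iterate_zero, id, pow_zero, one_mul]
    rw [abs_le]
    constructor <;> linarith
  | succ n ih =>
    -- The operator turns `K` into `(C + K) / 2 ≤ 3K/4`; this gain pays for the subtraction of `t`.
    have hF : LogLip (3 * K / 4) (ruelleOp ν B f) := (hf.ruelleOp ν hC).mono (by linarith)
    have hFS : ∀ z, ruelleOp ν B f z ≤ S := fun z =>
      (ruelleOp_mono ν hBc hf.continuous continuous_const hS z).trans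
        (hB.ruelleOp_const S z).le
    obtain ⟨m, -, hm⟩ := isCompact_univ.exists_isMaxOn ⟨x, trivial⟩ hF.continuous.continuousOn
    have hmax : ∀ z, ruelleOp ν B f z ≤ ruelleOp ν B f m := fun z => hm (Set.mem_univ z)
    -- Log-Lipschitz continuity gives `min ≥ e · max`, so `t` is at most a quarter of the function.
    -- Removing it preserves oscillations and lowers the upper bound by the factor `1 - e / 4`.
    set t := ruelleOp ν B f m * e / 4 with htd
    have ht : ∀ z, t ≤ ruelleOp ν B f z / 4 := by
      intro z
      have h1 := (hF.mono (K' := K) (by linarith)).2 m z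
      have h2 : Real.exp (K * seqDist m z) ≤ e⁻¹ := by
        rw [he, ← Real.exp_neg, neg_neg]
        have := seqDist_le_diam m z
        gcongr
      have h3 : ruelleOp ν B f m * e ≤ ruelleOp ν B f z := by
        rw [← le_div_iff₀ (Real.exp_pos _), div_eq_inv_mul]
        exact h1.trans (mul_le_mul_of_nonneg_right h2 (hF.1 z).le)
      rw [htd]
      linarith
    have key := ih (hF.sub_const hK ht) (S := (1 - e / 4) * S) (fun z => by
      have h4 : (1 - e / 4) * ruelleOp ν B f m ≤ (1 - e / 4) * S :=
        mul_le_mul_of_nonneg_left (hFS m) (by linarith)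
      have := hmax z
      rw [htd]
      linarith) x y
    have h5 := fun z => hB.iterate_add_const hF.continuous (-t) n z
    simp only [← sub_eq_add_neg] at h5
    rw [h5, h5, sub_sub_sub_cancel_right] at key
    rw [Function.iterate_succ_apply, pow_succ, mul_assoc]
    exact key

/-- The iterates of a Lipschitz function under the Ruelle operator of a normalized potential have
exponentially small oscillation. -/
lemma IsNormalized.exists_oscillation_bound (hB : IsNormalized ν B) {g : SymSeq M → ℝ}
    (hg : IsLip g) : ∃ r S : ℝ, 0 ≤ r ∧ r < 1 ∧ ∀ n x y,
      |(ruelleOp ν B)^[n] g x - (ruelleOp ν B)^[n] g y| ≤ r ^ n * S := by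
  obtain ⟨C, hC0, hC⟩ := hB.1.exists_nonneg
  have hK : 0 < 2 * C + 1 := by linarith
  obtain ⟨c, hc⟩ := hg.exists_logLip_add hK
  obtain ⟨S, hS⟩ := exists_abs_le_of_continuous hc.continuous
  have he1 : Real.exp (-((2 * C + 1) * Metric.diam (Set.univ : Set M))) ≤ 1 :=
    Real.exp_le_one_iff.mpr (by
      have := Metric.diam_nonneg (s := (Set.univ : Set M))
      have := mul_nonneg hK.le this
      linarith)
  have he0 := Real.exp_pos (-((2 * C + 1) * Metric.diam (Set.univ : Set M)))
  refine ⟨1 - Real.exp (-((2 * C + 1) * Metric.diam (Set.univ : Set M))) / 4, S, by linarith,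
    by linarith, fun n x y => ?_⟩
  · have := hB.abs_iterate_sub_le hK.le (by linarith) hC n hc
      (fun x => (le_abs_self _).trans (hS x)) x y
    rw [hB.iterate_add_const hg.continuous, hB.iterate_add_const hg.continuous,
      add_sub_add_right_eq_sub] at this
    exact this

lemma IsNormalized.eq_of_fixed (hB : IsNormalized ν B) {g : SymSeq M → ℝ} (hg : IsLip g)
    (hfix : ∀ x, ruelleOp ν B g x = g x) (x y : SymSeq M) : g x = g y := by
  obtain ⟨r, S, hr0, hr1, hosc⟩ := hB.exists_oscillation_bound hg
  have hit : ∀ n, (ruelleOp ν B)^[n] g = g := Function.iterate_fixed (funext hfix)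
  have hlim : Filter.Tendsto (fun n : ℕ => r ^ n * S) Filter.atTop (nhds 0) := by
    simpa using (tendsto_pow_atTop_nhds_zero_of_lt_one hr0 hr1).mul_const S
  have hbound : ∀ n : ℕ, |g x - g y| ≤ r ^ n * S := fun n => by simpa only [hit] using hosc n x y
  have := ge_of_tendsto' hlim hbound
  exact sub_eq_zero.mp (abs_eq_zero.mp (le_antisymm this (abs_nonneg _)))

/-- `η` is fixed by the dual of the Ruelle operator of `B`. -/
def IsFixed (ν : Measure M) (B : SymSeq M → ℝ) (η : Measure (SymSeq M)) : Prop :=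
  ∀ f : SymSeq M → ℝ, Continuous f → ∫ x, ruelleOp ν B f x ∂η = ∫ x, f x ∂η

variable {η : Measure (SymSeq M)} [IsProbabilityMeasure η]

/-- Lipschitz functions are uniformly dense, and a normalized operator does not increase the sup
norm. -/
lemma IsNormalized.isFixed_of_isLip (hB : IsNormalized ν B)
    (h : ∀ f, IsLip f → ∫ x, ruelleOp ν B f x ∂η = ∫ x, f x ∂η) : IsFixed ν B η := by
  intro f hf
  have hBc := hB.1.continuous
  refine eq_of_forall_dist_le fun ε hε => ?_
  obtain ⟨g, hg, hfg⟩ := exists_isLip_near hf (half_pos hε)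
  have h1 : |∫ x, f x ∂η - ∫ x, g x ∂η| ≤ ε / 2 :=
    abs_integral_sub_le hf hg.continuous fun x => (hfg x).le
  have h2 : |∫ x, ruelleOp ν B f x ∂η - ∫ x, ruelleOp ν B g x ∂η| ≤ ε / 2 := by
    refine abs_integral_sub_le (continuous_ruelleOp ν hBc hf)
      (continuous_ruelleOp ν hBc hg.continuous) fun x => ?_
    rw [← ruelleOp_sub ν hBc hf hg.continuous, abs_le]
    constructor
    · rw [← hB.ruelleOp_const (-(ε / 2)) x]
      exact ruelleOp_mono ν hBc continuous_const (hf.sub hg.continuous)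
        (fun z => (abs_lt.mp (hfg z)).1.le) x
    · rw [← hB.ruelleOp_const (ε / 2) x]
      exact ruelleOp_mono ν hBc (hf.sub hg.continuous) continuous_const
        (fun z => (abs_lt.mp (hfg z)).2.le) x
  rw [h g hg] at h2
  rw [Real.dist_eq]
  rw [abs_le] at *
  constructor <;> linarith [h1.1, h1.2, h2.1, h2.2]

lemma measure_eq_of_integral_isLip_eq {η' : Measure (SymSeq M)} [IsProbabilityMeasure η']
    (h : ∀ f, IsLip f → ∫ x, f x ∂η = ∫ x, f x ∂η') : η = η' := by
  refine ext_of_forall_integral_eq_of_IsFiniteMeasure fun f =>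
    eq_of_forall_dist_le fun ε hε => ?_
  obtain ⟨g, hg, hfg⟩ := exists_isLip_near f.continuous (half_pos hε)
  have h1 := abs_integral_sub_le (μ := η) f.continuous hg.continuous fun x => (hfg x).le
  have h2 := abs_integral_sub_le (μ := η') f.continuous hg.continuous fun x => (hfg x).le
  rw [h g hg] at h1
  rw [Real.dist_eq]
  rw [abs_le] at *
  constructor <;> linarith [h1.1, h1.2, h2.1, h2.2]

omit [IsProbabilityMeasure η] in
lemma IsFixed.integral_iterate (hη : IsFixed ν B η) (hB : Continuous B) {f : SymSeq M → ℝ}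
    (hf : Continuous f) (n : ℕ) :
    ∫ x, (ruelleOp ν B)^[n] f x ∂η = ∫ x, f x ∂η := by
  induction n generalizing f with
  | zero => rfl
  | succ n ih =>
    rw [Function.iterate_succ_apply, ih (continuous_ruelleOp ν hB hf), hη f hf]

/-- Replacing `f` by its `n`-th iterate changes neither integral, and this iterate is within `r ^ n
* S` of its value at `x0`. -/
lemma IsNormalized.isFixed_unique (hB : IsNormalized ν B) {η' : Measure (SymSeq M)}
    [IsProbabilityMeasure η'] (hη : IsFixed ν B η) (hη' : IsFixed ν B η') : η = η' := by
  refine measure_eq_of_integral_isLip_eq fun f hf => ?_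
  obtain ⟨r, S, hr0, hr1, hosc⟩ := hB.exists_oscillation_bound hf
  obtain ⟨x0⟩ : Nonempty (SymSeq M) := nonempty_of_isProbabilityMeasure η
  have hlim : Filter.Tendsto (fun n : ℕ => r ^ n * S + r ^ n * S) Filter.atTop (nhds 0) := by
    simpa using ((tendsto_pow_atTop_nhds_zero_of_lt_one hr0 hr1).mul_const S).add
      ((tendsto_pow_atTop_nhds_zero_of_lt_one hr0 hr1).mul_const S)
  have hbound : ∀ n : ℕ, |∫ x, f x ∂η - ∫ x, f x ∂η'| ≤ r ^ n * S + r ^ n * S := by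
    intro n
    have hc := continuous_ruelleOp_iterate ν hB.1.continuous hf.continuous n
    have h1 := abs_integral_sub_le (μ := η) hc continuous_const fun x => hosc n x x0
    have h2 := abs_integral_sub_le (μ := η') hc continuous_const fun x => hosc n x x0
    rw [hη.integral_iterate hB.1.continuous hf.continuous] at h1
    rw [hη'.integral_iterate hB.1.continuous hf.continuous] at h2
    simp only [integral_const, probReal_univ, one_smul] at h1 h2
    rw [abs_le] at *
    constructor <;> linarith [h1.1, h1.2, h2.1, h2.2]
  exact sub_eq_zero.mp (abs_eq_zero.mp (le_antisymm (ge_of_tendsto' hlim hbound) (abs_nonneg _)))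

-- For normalized `B`, the operator sends `f ∘ shift` back to `f`.
omit [IsProbabilityMeasure ν] in
lemma IsFixed.isInvariantProb (hB : IsNormalized ν B) (hη : IsFixed ν B η) :
    IsInvariantProb η := by
  refine ⟨inferInstance, ?_⟩
  have hm : Measurable (shift : SymSeq M → SymSeq M) := continuous_shift.measurable
  have : IsProbabilityMeasure (η.map shift) := Measure.isProbabilityMeasure_map hm.aemeasurable
  refine ext_of_forall_integral_eq_of_IsFiniteMeasure fun f => ?_
  rw [integral_map hm.aemeasurable f.continuous.aestronglyMeasurable,
    ← hη (fun x => f (shift x)) (f.continuous.comp continuous_shift)]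
  congr 1
  ext x
  simpa [hB.ruelleOp_const] using ruelleOp_mul_comp_shift (ν := ν) (B := B) (fun _ => 1) f x

/-- The action of the dual of the Ruelle operator on measures. -/
noncomputable def dualRuelle (ν : Measure M) (B : SymSeq M → ℝ) (η : Measure (SymSeq M)) :
    Measure (SymSeq M) :=
  ((η.prod ν).withDensity fun p => ENNReal.ofReal (Real.exp (B (cons p.2 p.1)))).map
    fun p => cons p.2 p.1

lemma integral_dualRuelle (hB : Continuous B) {f : SymSeq M → ℝ} (hf : Continuous f) :
    ∫ x, f x ∂dualRuelle ν B η = ∫ x, ruelleOp ν B f x ∂η := by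
  have hc : Continuous fun p : SymSeq M × M => Real.exp (B (cons p.2 p.1)) :=
    (Real.continuous_exp.comp hB).comp continuous_cons_swap
  have hi : Integrable (fun p : SymSeq M × M => Real.exp (B (cons p.2 p.1)) * f (cons p.2 p.1))
      (η.prod ν) := integrable_of_continuous (hc.mul (hf.comp continuous_cons_swap))
  rw [dualRuelle, integral_map continuous_cons_swap.measurable.aemeasurable
    hf.aestronglyMeasurable, integral_withDensity_ofReal hc fun _ => (Real.exp_pos _).le,
    integral_prod _ hi]
  rfl

lemma IsNormalized.isProbabilityMeasure_dualRuelle (hB : IsNormalized ν B) :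
    IsProbabilityMeasure (dualRuelle ν B η) := by
  have hc : Continuous fun p : SymSeq M × M => Real.exp (B (cons p.2 p.1)) :=
    (Real.continuous_exp.comp hB.1.continuous).comp continuous_cons_swap
  have := isProbabilityMeasure_withDensity_ofReal (μ := η.prod ν) hc
    (fun _ => (Real.exp_pos _).le) (by
      rw [integral_prod _ (integrable_of_continuous hc)]
      simp [hB.2])
  exact Measure.isProbabilityMeasure_map continuous_cons_swap.measurable.aemeasurable

/-- Any cluster point of the dual iterates of a Dirac mass is fixed: the defect `∫ (L f - f) dμ n`
tends to zero because the iterates of `f` flatten out. -/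
lemma IsNormalized.exists_isFixed (hB : IsNormalized ν B) :
    ∃ η : Measure (SymSeq M), IsProbabilityMeasure η ∧ IsFixed ν B η := by
  have hBc := hB.1.continuous
  obtain ⟨a0⟩ : Nonempty M := nonempty_of_isProbabilityMeasure ν
  let x0 : SymSeq M := fun _ => a0
  have hseq : ∀ n : ℕ, ∃ μ : ProbabilityMeasure (SymSeq M), ∀ f, Continuous f →
      ∫ x, f x ∂(μ : Measure (SymSeq M)) = (ruelleOp ν B)^[n] f x0 := by
    intro n
    induction n with
    | zero => exact ⟨⟨Measure.dirac x0, inferInstance⟩, fun f hf => by simp⟩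
    | succ n ih =>
      obtain ⟨μ, hμ⟩ := ih
      refine ⟨⟨dualRuelle ν B μ, hB.isProbabilityMeasure_dualRuelle⟩, fun f hf => ?_⟩
      rw [ProbabilityMeasure.coe_mk, integral_dualRuelle hBc hf,
        hμ _ (continuous_ruelleOp ν hBc hf), Function.iterate_succ_apply]
  choose μ hμ using hseq
  obtain ⟨η, hη⟩ := exists_clusterPt_of_compactSpace (Filter.map μ Filter.atTop)
  refine ⟨η, inferInstance, hB.isFixed_of_isLip fun f hf => ?_⟩
  obtain ⟨r, S, hr0, hr1, hosc⟩ := hB.exists_oscillation_bound hf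
  have hLf := continuous_ruelleOp ν hBc hf.continuous
  let F : BoundedContinuousFunction (SymSeq M) ℝ :=
    BoundedContinuousFunction.mkOfCompact ⟨fun x => ruelleOp ν B f x - f x,
      hLf.sub hf.continuous⟩
  have hFcont := (ProbabilityMeasure.tendsto_iff_forall_integral_tendsto.mp
    (Filter.tendsto_id (x := nhds η))) F
  have hclus : MapClusterPt (∫ x, F x ∂(η : Measure (SymSeq M))) Filter.atTop
      fun n => ∫ x, F x ∂(μ n : Measure (SymSeq M)) :=
    MapClusterPt.tendsto_comp hFcont hη
  have hzero : Filter.Tendsto (fun n => ∫ x, F x ∂(μ n : Measure (SymSeq M))) Filter.atTop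
      (nhds 0) := by
    refine squeeze_zero_norm (a := fun n => r ^ n * S) (fun n => ?_) (by
      simpa using (tendsto_pow_atTop_nhds_zero_of_lt_one hr0 hr1).mul_const S)
    have hc := continuous_ruelleOp_iterate ν hBc hf.continuous n
    -- Writing the second term as the operator applied to a constant turns the defect into the
    -- operator applied to a function bounded by the oscillation.
    have e1 : ∫ x, F x ∂(μ n : Measure (SymSeq M)) =
        ruelleOp ν B ((ruelleOp ν B)^[n] f) x0 -
          ruelleOp ν B (fun _ => (ruelleOp ν B)^[n] f x0) x0 := by
      change ∫ x, (ruelleOp ν B f x - f x) ∂(μ n : Measure (SymSeq M)) = _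
      rw [integral_sub (integrable_of_continuous hLf) (integrable_of_continuous hf.continuous),
        hμ n _ hLf, hμ n _ hf.continuous, ← Function.iterate_succ_apply,
        Function.iterate_succ_apply', hB.ruelleOp_const]
    rw [e1, ← ruelleOp_sub ν hBc hc continuous_const, Real.norm_eq_abs, abs_le]
    constructor
    · rw [← hB.ruelleOp_const (-(r ^ n * S)) x0]
      exact ruelleOp_mono ν hBc continuous_const (hc.sub continuous_const)
        (fun z => (abs_le.mp (hosc n z x0)).1) x0
    · rw [← hB.ruelleOp_const (r ^ n * S) x0]
      exact ruelleOp_mono ν hBc (hc.sub continuous_const) continuous_const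
        (fun z => (abs_le.mp (hosc n z x0)).2) x0
  have h0 : ∫ x, F x ∂(η : Measure (SymSeq M)) = 0 := by
    have : (nhds (∫ x, F x ∂(η : Measure (SymSeq M))) ⊓ nhds 0).NeBot :=
      hclus.clusterPt.mono hzero
    exact eq_of_nhds_neBot this
  rw [← sub_eq_zero, ← integral_sub (integrable_of_continuous hLf)
    (integrable_of_continuous hf.continuous)]
  exact h0

end Normalized

/-- The inequality `1 + s ≤ e^s` at `s = log f(y) - log f(x)` bounds `f x - f y` by `f x` times a
difference of logarithms. -/
lemma LogLip.isLip {M : Type*} [MetricSpace M] [CompactSpace M] {K : ℝ} {f : SymSeq M → ℝ}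
    (hf : LogLip K f) : IsLip f := by
  obtain ⟨S, hS⟩ := exists_abs_le_of_continuous hf.continuous
  have key : ∀ x y, f x - f y ≤ S * K * seqDist x y := fun x y => by
    have h1 := Real.add_one_le_exp (Real.log (f y) - Real.log (f x))
    rw [Real.exp_sub, Real.exp_log (hf.1 x), Real.exp_log (hf.1 y), le_div_iff₀ (hf.1 x)] at h1
    have h2 := (logLip_iff_log hf.1).mp hf x y
    calc f x - f y ≤ f x * (Real.log (f x) - Real.log (f y)) := by linarith
      _ ≤ f x * |Real.log (f x) - Real.log (f y)| :=
        mul_le_mul_of_nonneg_left (le_abs_self _) (hf.1 x).le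
      _ ≤ S * (K * seqDist x y) :=
        mul_le_mul ((le_abs_self _).trans (hS x)) h2 (abs_nonneg _) ((abs_nonneg _).trans (hS x))
      _ = _ := by ring
  refine ⟨S * K, fun x y => abs_sub_le_iff.mpr ⟨key x y, ?_⟩⟩
  rw [seqDist_comm]
  exact key y x

/-! ### Eigenpairs, normalization and equilibria. -/

section Equilibrium

variable {M : Type*} [MetricSpace M] [CompactSpace M] [MeasurableSpace M] [BorelSpace M]
  {ν : Measure M} [IsProbabilityMeasure ν] {A : SymSeq M → ℝ}

/-- `h` is a positive continuous eigenfunction of the Ruelle operator of `A`, with positive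
eigenvalue `ev`. -/
structure IsEigenpair (ν : Measure M) (A : SymSeq M → ℝ) (ev : ℝ) (h : SymSeq M → ℝ) : Prop where
  ev_pos : 0 < ev
  continuous : Continuous h
  pos : ∀ x, 0 < h x
  eigen : ∀ x, ruelleOp ν A h x = ev * h x

variable {ev ev' : ℝ} {h h' : SymSeq M → ℝ}

-- Normalizing the potential conjugates the operator by multiplication by `h` and divides it by
-- `ev`.
omit [CompactSpace M] [BorelSpace M] [IsProbabilityMeasure ν] in
lemma IsEigenpair.ruelleOp_normalizedPotential (he : IsEigenpair ν A ev h) (f : SymSeq M → ℝ)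
    (x : SymSeq M) :
    ruelleOp ν (normalizedPotential A h ev) f x =
      ruelleOp ν A (fun z => h z * f z) x / (ev * h x) := by
  simp only [ruelleOp, normalizedPotential, ← integral_div, shift_cons]
  congr 1
  ext a
  rw [Real.exp_sub, Real.exp_sub, Real.exp_add, Real.exp_log (he.pos _), Real.exp_log (he.pos _),
    Real.exp_log he.ev_pos]
  have := (he.pos x).ne'
  have := he.ev_pos.ne'
  field_simp

lemma IsEigenpair.exists_logLip (he : IsEigenpair ν A ev h) (hA : IsLip A) :
    ∃ C, LogLip C h := by
  obtain ⟨C, hC0, hC⟩ := hA.exists_nonneg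
  exact ⟨C, logLip_of_eigenfunction ν hC0 hC he.continuous he.pos he.ev_pos he.eigen⟩

lemma IsEigenpair.isNormalized (he : IsEigenpair ν A ev h) (hA : IsLip A) :
    IsNormalized ν (normalizedPotential A h ev) := by
  obtain ⟨C, hC⟩ := he.exists_logLip hA
  refine ⟨((hA.add hC.isLip_log).sub hC.isLip_log.comp_shift).sub (isLip_const _), fun x => ?_⟩
  have := he.ruelleOp_normalizedPotential (fun _ => 1) x
  simp only [mul_one, he.eigen] at this
  rw [div_self (mul_pos he.ev_pos (he.pos x)).ne'] at this
  simpa [ruelleOp] using this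

/-- The positive eigenfunction of a Lipschitz potential is unique up to a factor. -/
lemma IsEigenpair.unique (he : IsEigenpair ν A ev h) (he' : IsEigenpair ν A ev' h')
    (hA : IsLip A) : ev' = ev ∧ ∃ c, 0 < c ∧ ∀ x, h' x = c * h x := by
  obtain ⟨C, hC⟩ := he.exists_logLip hA
  obtain ⟨C', hC'⟩ := he'.exists_logLip hA
  have hB := he.isNormalized hA
  have hg := hC'.div hC
  -- The quotient `h' / h` is a positive eigenfunction of a normalized operator. Integrating against
  -- a fixed probability forces its eigenvalue `ev' / ev` to be `1`; then the quotient is constant.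
  have hLg : ∀ x, ruelleOp ν (normalizedPotential A h ev) (fun z => h' z / h z) x =
      ev' / ev * (h' x / h x) := fun x => by
    rw [he.ruelleOp_normalizedPotential]
    have : (fun z => h z * (h' z / h z)) = h' := funext fun z => mul_div_cancel₀ _ (he.pos z).ne'
    rw [this, he'.eigen, mul_div_mul_comm]
  obtain ⟨η, hη, hfix⟩ := hB.exists_isFixed
  have hev : ev' = ev := by
    have h1 := hfix _ hg.continuous
    simp only [hLg] at h1
    rw [integral_const_mul] at h1
    have h2 := integral_pos_of_continuous (μ := η) hg.continuous hg.1
    exact (div_eq_one_iff_eq he.ev_pos.ne').mp (mul_right_cancel₀ h2.ne' (h1.trans (one_mul _).symm))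
  obtain ⟨x0⟩ : Nonempty (SymSeq M) := nonempty_of_isProbabilityMeasure η
  refine ⟨hev, h' x0 / h x0, hg.1 x0, fun x => ?_⟩
  have := hB.eq_of_fixed hg.isLip (fun x => by
    rw [hLg, hev, div_self he.ev_pos.ne', one_mul]) x x0
  rw [← this, div_mul_cancel₀ _ (he.pos x).ne']

lemma IsEigenpair.normalizedPotential_eq (he : IsEigenpair ν A ev h)
    (he' : IsEigenpair ν A ev' h') (hA : IsLip A) :
    normalizedPotential A h' ev' = normalizedPotential A h ev := by
  obtain ⟨rfl, c, hc, hh⟩ := he.unique he' hA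
  ext x
  simp only [normalizedPotential, hh]
  rw [Real.log_mul hc.ne' (he.pos _).ne', Real.log_mul hc.ne' (he.pos _).ne']
  ring

lemma IsEigenpair.isNuEquilibrium_iff (he : IsEigenpair ν A ev h) (hA : IsLip A)
    {μ : Measure (SymSeq M)} : IsNuEquilibrium ν A μ ↔
      IsProbabilityMeasure μ ∧ IsFixed ν (normalizedPotential A h ev) μ := by
  constructor
  · rintro ⟨hμ, ev', h', h1, h2, h3, h4, h5⟩
    rw [he.normalizedPotential_eq ⟨h1, h2, h3, h4⟩ hA] at h5
    exact ⟨hμ, h5⟩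
  · rintro ⟨hμ, h5⟩
    exact ⟨hμ, ev, h, he.ev_pos, he.continuous, he.pos, he.eigen, h5⟩

end Equilibrium

/-! ### The variational principle. -/

section Variational

variable {M : Type*} [MetricSpace M] [CompactSpace M] [MeasurableSpace M] [BorelSpace M]
  {ν : Measure M} [IsProbabilityMeasure ν] {B : SymSeq M → ℝ} {η : Measure (SymSeq M)}

-- Gibbs inequality: `B' - B ≤ e^{B' - B} - 1`, whose right side has integral zero because the
-- operator of `B` maps `e^{B' - B}` to `1`.
omit [IsProbabilityMeasure ν] in
lemma IsFixed.integral_le [IsProbabilityMeasure η] (hη : IsFixed ν B η) (hB : IsNormalized ν B)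
    {B' : SymSeq M → ℝ} (hB' : IsNormalized ν B') : ∫ x, B' x ∂η ≤ ∫ x, B x ∂η := by
  have hc := hB.1.continuous
  have hc' := hB'.1.continuous
  have he : Continuous fun x => Real.exp (B' x - B x) := Real.continuous_exp.comp (hc'.sub hc)
  have h1 : ∫ x, (B' x - B x) ∂η ≤ ∫ x, (Real.exp (B' x - B x) - 1) ∂η :=
    integral_mono (integrable_of_continuous (hc'.sub hc))
      (integrable_of_continuous (he.sub continuous_const)) fun x => by
        have := Real.add_one_le_exp (B' x - B x)
        simp only
        linarith
  have h2 : ∀ x, ruelleOp ν B (fun x => Real.exp (B' x - B x)) x = 1 := fun x => by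
    rw [← hB'.2 x]
    simp only [ruelleOp, ← Real.exp_add, add_sub_cancel]
  rw [integral_sub (integrable_of_continuous hc') (integrable_of_continuous hc),
    integral_sub (integrable_of_continuous he) (integrable_const _), ← hη _ he] at h1
  simp only [h2, integral_const, probReal_univ, one_smul] at h1
  linarith

omit [CompactSpace M] [BorelSpace M] [IsProbabilityMeasure ν] in
lemma IsNormalized.relEntropy_le (hB : IsNormalized ν B) :
    relEntropy ν η ≤ ((-∫ x, B x ∂η : ℝ) : EReal) := by
  rw [relEntropy, EReal.coe_neg, EReal.neg_le_neg_iff]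
  exact le_iSup₂ (f := fun (B : SymSeq M → ℝ) (_ : IsNormalized ν B) =>
    ((∫ x, B x ∂η : ℝ) : EReal)) B hB

omit [IsProbabilityMeasure ν] in
lemma IsFixed.relEntropy_eq [IsProbabilityMeasure η] (hη : IsFixed ν B η)
    (hB : IsNormalized ν B) : relEntropy ν η = ((-∫ x, B x ∂η : ℝ) : EReal) := by
  refine le_antisymm hB.relEntropy_le ?_
  rw [relEntropy, EReal.coe_neg, EReal.neg_le_neg_iff]
  exact iSup₂_le fun B' hB' => EReal.coe_le_coe_iff.mpr (hη.integral_le hB hB')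

lemma IsInvariantProb.integral_comp_shift (hη : IsInvariantProb η) {f : SymSeq M → ℝ}
    (hf : Continuous f) : ∫ x, f (shift x) ∂η = ∫ x, f x ∂η := by
  conv_rhs => rw [← hη.2]
  rw [integral_map continuous_shift.measurable.aemeasurable hf.aestronglyMeasurable]

/-- The `ν`-normalized perturbation `B + g - log (L_B e^g) ∘ σ` of a normalized potential. -/
lemma IsNormalized.perturb (hB : IsNormalized ν B) {g : SymSeq M → ℝ} (hg : IsLip g) :
    IsNormalized ν fun x =>
      B x + g x - Real.log (ruelleOp ν B (fun z => Real.exp (g z)) (shift x)) := by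
  obtain ⟨C, hC⟩ := hB.1
  obtain ⟨D, hD⟩ := hg
  have hL := (logLip_exp hD).ruelleOp ν hC
  refine ⟨(hB.1.add ⟨D, hD⟩).sub hL.isLip_log.comp_shift, fun x => ?_⟩
  have hpos := hL.1 x
  simp only [shift_cons, Real.exp_sub, Real.exp_add, Real.exp_log hpos]
  rw [integral_div]
  exact div_self hpos.ne'

/-- An invariant probability that maximizes the integral of normalized potentials at `B` is fixed
by the dual of the Ruelle operator of `B`. -/
lemma IsNormalized.isFixed_of_forall_integral_le (hB : IsNormalized ν B)
    (hη : IsInvariantProb η)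
    (hmax : ∀ B', IsNormalized ν B' → ∫ x, B' x ∂η ≤ ∫ x, B x ∂η) : IsFixed ν B η := by
  have : IsProbabilityMeasure η := hη.1
  have hBc := hB.1.continuous
  have key : ∀ g, IsLip g → ∫ x, g x ∂η ≤ ∫ x, ruelleOp ν B g x ∂η := by
    intro g hg
    have hgc := hg.continuous
    have hLg := continuous_ruelleOp ν hBc hgc
    obtain ⟨G, hG⟩ := exists_abs_le_of_continuous hgc
    have hG0 : 0 ≤ G := by
      obtain ⟨x0⟩ : Nonempty (SymSeq M) := nonempty_of_isProbabilityMeasure η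
      exact (abs_nonneg _).trans (hG x0)
    -- First-order optimality: maximality against the perturbation by `t g` gives `t ∫ g ≤ ∫ log L
    -- e^{t g}`, and the right side is at most `t ∫ L g + t² G²`.
    have small : ∀ t : ℝ, 0 < t → t * G ≤ 1 →
        ∫ x, g x ∂η ≤ ∫ x, ruelleOp ν B g x ∂η + t * G ^ 2 := by
      intro t ht htG
      have htg : IsLip fun x => t * g x := hg.const_mul t
      have hec : Continuous fun x => Real.exp (t * g x) := Real.continuous_exp.comp htg.continuous
      set E := ruelleOp ν B (fun x => Real.exp (t * g x)) with hE
      have hEc : Continuous E := continuous_ruelleOp ν hBc hec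
      have hEpos : ∀ x, 0 < E x := ruelleOp_pos ν hBc hec fun _ => Real.exp_pos _
      have hlog : Continuous fun x => Real.log (E x) := hEc.log fun x => (hEpos x).ne'
      have hls : Continuous fun x => Real.log (E (shift x)) := hlog.comp continuous_shift
      have h1 := hmax _ (hB.perturb htg)
      have hBt : Continuous fun x => B x + t * g x := hBc.add htg.continuous
      rw [← hE, integral_sub (integrable_of_continuous hBt)
        (integrable_of_continuous hls), integral_add (integrable_of_continuous hBc)
        (integrable_of_continuous htg.continuous), integral_const_mul,
        hη.integral_comp_shift hlog] at h1
      have hquad : ∀ x, Real.exp (t * g x) ≤ t * g x + (1 + t ^ 2 * G ^ 2) := by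
        intro x
        have habs : |t * g x| ≤ t * G := by
          rw [abs_mul, abs_of_pos ht]
          exact mul_le_mul_of_nonneg_left (hG x) ht.le
        have h2 := (abs_le.mp (Real.abs_exp_sub_one_sub_id_le (habs.trans htG))).2
        have h3 : (t * g x) ^ 2 ≤ t ^ 2 * G ^ 2 := by
          rw [← mul_pow, ← sq_abs]
          exact pow_le_pow_left₀ (abs_nonneg _) habs 2
        linarith
      have h4 : ∀ x, Real.log (E x) ≤ t * ruelleOp ν B g x + t ^ 2 * G ^ 2 := by
        intro x
        have h5 := ruelleOp_mono ν hBc hec (htg.add (isLip_const _)).continuous hquad x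
        rw [ruelleOp_add ν hBc htg.continuous continuous_const, ruelleOp_const_mul,
          hB.ruelleOp_const] at h5
        have h6 := Real.log_le_sub_one_of_pos (hEpos x)
        linarith
      have htL : Continuous fun x => t * ruelleOp ν B g x := continuous_const.mul hLg
      have h7 : ∫ x, Real.log (E x) ∂η ≤ ∫ x, (t * ruelleOp ν B g x + t ^ 2 * G ^ 2) ∂η :=
        integral_mono (integrable_of_continuous hlog)
          (integrable_of_continuous (htL.add continuous_const)) h4
      rw [integral_add (integrable_of_continuous htL) (integrable_const _),
        integral_const_mul] at h7
      simp only [integral_const, probReal_univ, one_smul] at h7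
      have h8 : t * ∫ x, g x ∂η ≤ t * (∫ x, ruelleOp ν B g x ∂η + t * G ^ 2) := by linarith
      exact le_of_mul_le_mul_left h8 ht
    refine le_of_forall_pos_le_add fun ε hε => ?_
    -- The inverse of this number is a value of `t` with `t G ≤ 1` and `t G² ≤ ε`.
    have hd : 0 < 1 + G + G ^ 2 / ε := by positivity
    have h1 : (1 + G + G ^ 2 / ε)⁻¹ * G ≤ 1 := by
      rw [inv_mul_le_iff₀ hd]
      have : 0 ≤ G ^ 2 / ε := by positivity
      linarith
    have h2 : (1 + G + G ^ 2 / ε)⁻¹ * G ^ 2 ≤ ε := by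
      rw [inv_mul_le_iff₀ hd]
      have : G ^ 2 / ε * ε = G ^ 2 := div_mul_cancel₀ _ hε.ne'
      nlinarith
    linarith [small _ (inv_pos.mpr hd) h1]
  refine hB.isFixed_of_isLip fun g hg => le_antisymm ?_ (key g hg)
  -- The first-order inequality for `-g` is the reverse one for `g`.
  have h1 := key _ (hg.const_mul (-1))
  simp only [ruelleOp_const_mul, integral_const_mul] at h1
  linarith

variable {A h : SymSeq M → ℝ} {ev : ℝ}

-- The coboundary `log h - log (h ∘ shift)` integrates to zero.
omit [IsProbabilityMeasure ν] in
lemma IsEigenpair.integral_eq (he : IsEigenpair ν A ev h) (hA : IsLip A)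
    (hη : IsInvariantProb η) :
    ∫ x, A x ∂η = ∫ x, normalizedPotential A h ev x ∂η + Real.log ev := by
  have : IsProbabilityMeasure η := hη.1
  have hlog : Continuous fun x => Real.log (h x) := he.continuous.log fun x => (he.pos x).ne'
  have hls : Continuous fun x => Real.log (h (shift x)) := hlog.comp continuous_shift
  have hAc := hA.continuous
  have hAl : Continuous fun x => A x + Real.log (h x) := hAc.add hlog
  have hAls : Continuous fun x => A x + Real.log (h x) - Real.log (h (shift x)) := hAl.sub hls
  simp only [normalizedPotential]
  rw [integral_sub (integrable_of_continuous hAls) (integrable_const _),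
    integral_sub (integrable_of_continuous hAl) (integrable_of_continuous hls),
    integral_add (integrable_of_continuous hAc) (integrable_of_continuous hlog),
    hη.integral_comp_shift hlog]
  simp

lemma IsEigenpair.add_relEntropy_of_isFixed (he : IsEigenpair ν A ev h) (hA : IsLip A)
    [IsProbabilityMeasure η] (hη : IsFixed ν (normalizedPotential A h ev) η) :
    ((∫ x, A x ∂η : ℝ) : EReal) + relEntropy ν η = (Real.log ev : ℝ) := by
  have hB := he.isNormalized hA
  rw [he.integral_eq hA (hη.isInvariantProb hB), hη.relEntropy_eq hB, ← EReal.coe_add]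
  congr 1
  ring

/-- Testing the entropy with the normalized potential itself gives the upper bound; a fixed
probability realizes it. -/
lemma IsEigenpair.pressure_eq (he : IsEigenpair ν A ev h) (hA : IsLip A) :
    pressure ν A = (Real.log ev : ℝ) := by
  have hB := he.isNormalized hA
  refine le_antisymm (iSup₂_le fun η hη => ?_) ?_
  · refine (add_le_add_right hB.relEntropy_le _).trans ?_
    rw [he.integral_eq hA hη, ← EReal.coe_add, EReal.coe_le_coe_iff]
    linarith
  · obtain ⟨η, hηp, hη⟩ := hB.exists_isFixed
    rw [← he.add_relEntropy_of_isFixed hA hη]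
    exact le_iSup₂ (f := fun (η : Measure (SymSeq M)) (_ : IsInvariantProb η) =>
      ((∫ x, A x ∂η : ℝ) : EReal) + relEntropy ν η) η (hη.isInvariantProb hB)

/-- The measures that attain the pressure of a Lipschitz potential are the fixed points of the
dual of the normalized Ruelle operator. -/
lemma IsEigenpair.attainsPressure_iff (he : IsEigenpair ν A ev h) (hA : IsLip A) :
    AttainsPressure ν A η ↔
      IsProbabilityMeasure η ∧ IsFixed ν (normalizedPotential A h ev) η := by
  have hB := he.isNormalized hA
  constructor
  · rintro ⟨hη, heq⟩
    refine ⟨hη.1, hB.isFixed_of_forall_integral_le hη fun B' hB' => ?_⟩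
    rw [he.pressure_eq hA, he.integral_eq hA hη] at heq
    have h1 := (heq.symm.trans_le (add_le_add_right (hB'.relEntropy_le (η := η)) _))
    rw [← EReal.coe_add, EReal.coe_le_coe_iff] at h1
    linarith
  · rintro ⟨hηp, hη⟩
    exact ⟨hη.isInvariantProb hB, by
      rw [he.add_relEntropy_of_isFixed hA hη, he.pressure_eq hA]⟩

end Variational

/-! ### The bilateral shift, and uniqueness of invariant extensions. -/

section BiShift

variable {M : Type*}

lemma biShift_iterate_snd (n : ℕ) (y y' x : SymSeq M) :
    ((biShift M)^[n] (y, x)).2 = ((biShift M)^[n] (y', x)).2 := by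
  induction n with
  | zero => rfl
  | succ n ih =>
    rw [Function.iterate_succ_apply', Function.iterate_succ_apply']
    exact congrArg shift ih

lemma biShift_iterate_fst (n i : ℕ) (hi : i < n) (y y' x : SymSeq M) :
    ((biShift M)^[n] (y, x)).1 i = ((biShift M)^[n] (y', x)).1 i := by
  induction n generalizing i with
  | zero => omega
  | succ n ih =>
    rw [Function.iterate_succ_apply', Function.iterate_succ_apply']
    cases i with
    | zero => exact congrFun (biShift_iterate_snd n y y' x) 0
    | succ i => exact ih i (by omega)

variable [MetricSpace M]

lemma continuous_biShift : Continuous (biShift M) := by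
  change Continuous fun p : SymSeq M × SymSeq M => (cons (p.2 0) p.1, shift p.2)
  have h : Continuous fun p : SymSeq M × SymSeq M => (p.2 0, p.1) := by fun_prop
  exact (continuous_cons.comp h).prodMk (continuous_shift.comp continuous_snd)

lemma continuous_biShift_symm : Continuous (biShift M).symm := by
  change Continuous fun p : SymSeq M × SymSeq M => (shift p.1, cons (p.1 0) p.2)
  have h : Continuous fun p : SymSeq M × SymSeq M => (p.1 0, p.2) := by fun_prop
  exact (continuous_shift.comp continuous_fst).prodMk (continuous_cons.comp h)

variable [CompactSpace M]

/-- Under many iterates of the bilateral shift the dependence on the past becomes negligible. -/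
lemma eventually_abs_biShift_iterate_sub_lt {F : SymSeq M × SymSeq M → ℝ} (hF : Continuous F)
    (y₀ : SymSeq M) {ε : ℝ} (hε : 0 < ε) : ∀ᶠ n in Filter.atTop, ∀ p : SymSeq M × SymSeq M,
      |F ((biShift M)^[n] p) - F ((biShift M)^[n] (y₀, p.2))| < ε := by
  -- The filter `⊤` on the points encodes uniformity in `p`. Coordinate `i` of the pasts agrees as
  -- soon as `n > i`, and the futures always agree.
  have hT : Filter.Tendsto (fun q : ℕ × (SymSeq M × SymSeq M) =>
      ((biShift M)^[q.1] q.2, (biShift M)^[q.1] (y₀, q.2.2))) (Filter.atTop ×ˢ ⊤)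
      (uniformity (SymSeq M × SymSeq M)) := by
    rw [uniformity_prod, Filter.tendsto_inf, Filter.tendsto_comap_iff, Filter.tendsto_comap_iff,
      Pi.uniformity, Filter.tendsto_iInf, Filter.tendsto_iInf]
    refine ⟨fun i => ?_, fun i => ?_⟩
    · rw [Filter.tendsto_comap_iff]
      intro V hV
      rw [Filter.mem_map]
      filter_upwards [(Filter.eventually_gt_atTop i).prod_inl ⊤] with q hq
      have := biShift_iterate_fst q.1 i hq q.2.1 y₀ q.2.2
      simp only [Function.comp, Set.mem_preimage]
      rw [← this]
      exact refl_mem_uniformity hV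
    · rw [Filter.tendsto_comap_iff]
      intro V hV
      rw [Filter.mem_map]
      filter_upwards with q
      have := congrFun (biShift_iterate_snd q.1 q.2.1 y₀ q.2.2) i
      simp only [Function.comp, Set.mem_preimage]
      rw [← this]
      exact refl_mem_uniformity hV
  have hu := CompactSpace.uniformContinuous_of_continuous hF
  have h := (hT.eventually (hu (Metric.dist_mem_uniformity hε))).curry
  filter_upwards [h] with n hn p
  exact (Filter.eventually_top.mp hn) p

variable [MeasurableSpace M] [BorelSpace M]

lemma IsInvariantExtension.integral_iterate {μ : Measure (SymSeq M)}
    {m : Measure (SymSeq M × SymSeq M)} (hm : IsInvariantExtension μ m)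
    {F : SymSeq M × SymSeq M → ℝ} (hF : Continuous F) (n : ℕ) :
    ∫ p, F ((biShift M)^[n] p) ∂m = ∫ p, F p ∂m := by
  have hmp : MeasurePreserving (biShift M) m m := ⟨continuous_biShift.measurable, hm.2.1⟩
  have hmn := hmp.iterate n
  conv_rhs => rw [← hmn.map_eq]
  rw [integral_map hmn.measurable.aemeasurable hF.aestronglyMeasurable]

/-- An invariant probability on the bilateral space is determined by its marginal on `Ω⁺`. -/
lemma IsInvariantExtension.unique {μ : Measure (SymSeq M)}
    {m m' : Measure (SymSeq M × SymSeq M)} (hm : IsInvariantExtension μ m)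
    (hm' : IsInvariantExtension μ m') : m = m' := by
  have : IsProbabilityMeasure m := hm.1
  have : IsProbabilityMeasure m' := hm'.1
  obtain ⟨p0⟩ : Nonempty (SymSeq M × SymSeq M) := nonempty_of_isProbabilityMeasure m
  refine ext_of_forall_integral_eq_of_IsFiniteMeasure fun F =>
    eq_of_forall_dist_le fun ε hε => ?_
  obtain ⟨n, hn⟩ :=
    (eventually_abs_biShift_iterate_sub_lt F.continuous p0.1 (half_pos hε)).exists
  have hc : Continuous ((biShift M)^[n]) := continuous_biShift.iterate n
  have hc1 : Continuous fun p => F ((biShift M)^[n] p) := F.continuous.comp hc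
  have hc0 : Continuous fun x => F ((biShift M)^[n] (p0.1, x)) :=
    hc1.comp (continuous_const.prodMk continuous_id)
  have hc2 : Continuous fun p : SymSeq M × SymSeq M => F ((biShift M)^[n] (p0.1, p.2)) :=
    hc0.comp continuous_snd
  -- Up to `ε / 2`, the integral of `F` is that of a function of `x` alone, so it depends only on
  -- the marginal `μ`.
  have key : ∀ m : Measure (SymSeq M × SymSeq M), IsInvariantExtension μ m →
      |∫ p, F p ∂m - ∫ x, F ((biShift M)^[n] (p0.1, x)) ∂μ| ≤ ε / 2 := by
    intro m hm
    have : IsProbabilityMeasure m := hm.1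
    have h1 := abs_integral_sub_le (μ := m) hc1 hc2 fun p => (hn p).le
    rw [hm.integral_iterate F.continuous] at h1
    rwa [← hm.2.2, integral_map measurable_snd.aemeasurable hc0.aestronglyMeasurable]
  have h1 := key m hm
  have h2 := key m' hm'
  rw [Real.dist_eq]
  rw [abs_le] at *
  constructor <;> linarith [h1.1, h1.2, h2.1, h2.2]

end BiShift

/-! ### The natural extension built from the involution kernel. -/

section NaturalExtension

variable {M : Type*} [MetricSpace M] [CompactSpace M] [MeasurableSpace M] [BorelSpace M]
  {ν : Measure M} [IsProbabilityMeasure ν]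

/-- The measure `k(y, x) dρ(y) dμ(x)`, for a normalized multiplicative involution kernel `k` between
normalized potentials with fixed measures `μ` and `ρ`, is the invariant extension of `μ`, and
its other marginal is `ρ`. -/
lemma isInvariantExtension_withDensity {B B' : SymSeq M → ℝ} (hB : IsNormalized ν B)
    {μ ρ : Measure (SymSeq M)} [IsProbabilityMeasure μ]
    [IsProbabilityMeasure ρ] (hμ : IsFixed ν B μ) (hρ : IsFixed ν B' ρ)
    {k : SymSeq M × SymSeq M → ℝ} (hk : Continuous k) (hkpos : ∀ p, 0 < k p)
    (hdual : ∀ a y x, Real.exp (B' (cons a y)) * k (cons a y, x) =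
      Real.exp (B (cons a x)) * k (y, cons a x))
    (hk1 : ∀ y, ∫ x, k (y, x) ∂μ = 1) :
    IsInvariantExtension μ ((ρ.prod μ).withDensity fun p => ENNReal.ofReal (k p)) ∧
      ((ρ.prod μ).withDensity fun p => ENNReal.ofReal (k p)).map Prod.fst = ρ := by
  have hBc := hB.1.continuous
  set m := (ρ.prod μ).withDensity fun p => ENNReal.ofReal (k p) with hm
  have hint : ∀ F : SymSeq M × SymSeq M → ℝ, ∫ p, F p ∂m = ∫ p, k p * F p ∂(ρ.prod μ) := fun F =>
    integral_withDensity_ofReal hk (fun p => (hkpos p).le) F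
  have hslice : ∀ {G : SymSeq M × SymSeq M → ℝ}, Continuous G → ∀ y, Continuous fun x => G (y, x) :=
    fun hG y => hG.comp (continuous_const.prodMk continuous_id)
  have hslice' : ∀ {G : SymSeq M × SymSeq M → ℝ}, Continuous G → ∀ x, Continuous fun y => G (y, x) :=
    fun hG x => hG.comp (continuous_id.prodMk continuous_const)
  have hprob : IsProbabilityMeasure m :=
    isProbabilityMeasure_withDensity_ofReal hk (fun p => (hkpos p).le) (by
      rw [integral_prod _ (integrable_of_continuous hk)]
      simp [hk1])
  -- exchanging the two normalized Ruelle operators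
  have hexch : ∀ {F : SymSeq M × SymSeq M → ℝ}, Continuous F → ∀ x,
      ∫ y, ruelleOp ν B (fun z => k (y, z) * F (y, z)) x ∂ρ =
        ∫ y, k (y, x) * F ((biShift M).symm (y, x)) ∂ρ := by
    intro F hF x
    rw [← hρ (fun y => k (y, x) * F ((biShift M).symm (y, x)))
      (hslice' (hk.mul (hF.comp continuous_biShift_symm)) x)]
    congr 1
    ext y
    simp only [ruelleOp]
    congr 1
    ext a
    have : (biShift M).symm (cons a y, x) = (y, cons a x) := rfl
    rw [this, ← mul_assoc, ← mul_assoc, hdual]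
  set g : SymSeq M → ℝ := fun x => ∫ y, k (y, x) ∂ρ with hg
  have hgc : Continuous g :=
    continuous_integral_of_continuous (f := fun x y => k (y, x)) (hk.comp continuous_swap)
  have hkx : ∀ {F : SymSeq M × SymSeq M → ℝ}, Continuous F →
      Continuous fun p : (SymSeq M × SymSeq M) × M =>
        Real.exp (B (cons p.2 p.1.2)) * F (p.1.1, cons p.2 p.1.2) := by
    intro F hF
    have hc : Continuous fun p : (SymSeq M × SymSeq M) × M => cons p.2 p.1.2 :=
      continuous_cons.comp (continuous_snd.prodMk (continuous_snd.comp continuous_fst))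
    exact (Real.continuous_exp.comp (hBc.comp hc)).mul
      (hF.comp ((continuous_fst.comp continuous_fst).prodMk hc))
  -- With `F = 1` the exchange identity makes the density `g` of the `Ω⁺` marginal a positive
  -- eigenfunction. Uniqueness makes it constant, and total mass one makes it `1`.
  have hLg : ∀ x, ruelleOp ν B g x = g x := by
    intro x
    have h1 := hexch (F := fun _ => 1) continuous_const x
    simp only [mul_one] at h1
    change _ = ∫ y, k (y, x) ∂ρ
    rw [← h1]
    simp only [hg, ruelleOp, ← integral_const_mul]
    refine integral_integral_swap (integrable_of_continuous ?_)
    have : Continuous fun q : M × SymSeq M => ((q.2, x), q.1) := by fun_prop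
    exact (hkx hk).comp this
  have hgpos : ∀ x, 0 < g x := fun x => integral_pos_of_continuous (hslice' hk x) fun _ => hkpos _
  have heig : IsEigenpair ν B 1 g := ⟨one_pos, hgc, hgpos, fun x => by rw [hLg, one_mul]⟩
  have heig1 : IsEigenpair ν B 1 fun _ => (1 : ℝ) :=
    ⟨one_pos, continuous_const, fun _ => one_pos, fun x => by rw [hB.ruelleOp_const, one_mul]⟩
  have hg1 : ∀ x, g x = 1 := by
    obtain ⟨-, c, -, hc⟩ := heig1.unique heig hB.1
    have h1 : ∫ x, g x ∂μ = 1 := by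
      rw [hg, ← integral_integral_swap (f := fun y x => k (y, x)) (integrable_of_continuous hk)]
      simp [hk1]
    simp only [hc, mul_one, integral_const, probReal_univ, one_smul] at h1
    intro x
    rw [hc, h1, mul_one]
  have hmapsnd : m.map Prod.snd = μ := by
    have : IsProbabilityMeasure (m.map Prod.snd) :=
      Measure.isProbabilityMeasure_map measurable_snd.aemeasurable
    refine ext_of_forall_integral_eq_of_IsFiniteMeasure fun f => ?_
    have hi : Integrable (fun p : SymSeq M × SymSeq M => k p * f p.2) (ρ.prod μ) :=
      integrable_of_continuous (hk.mul (f.continuous.comp continuous_snd))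
    rw [integral_map measurable_snd.aemeasurable f.continuous.aestronglyMeasurable, hint,
      integral_prod_symm _ hi]
    congr 1
    ext x
    simp only [integral_mul_const]
    rw [show ∫ y, k (y, x) ∂ρ = 1 from hg1 x, one_mul]
  have hmapfst : m.map Prod.fst = ρ := by
    have : IsProbabilityMeasure (m.map Prod.fst) :=
      Measure.isProbabilityMeasure_map measurable_fst.aemeasurable
    refine ext_of_forall_integral_eq_of_IsFiniteMeasure fun f => ?_
    have hi : Integrable (fun p : SymSeq M × SymSeq M => k p * f p.1) (ρ.prod μ) :=
      integrable_of_continuous (hk.mul (f.continuous.comp continuous_fst))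
    rw [integral_map measurable_fst.aemeasurable f.continuous.aestronglyMeasurable, hint,
      integral_prod _ hi]
    congr 1
    ext y
    simp only [integral_mul_const, hk1, one_mul]
  have hinv : ∀ {F : SymSeq M × SymSeq M → ℝ}, Continuous F →
      ∫ p, F p ∂m = ∫ p, F ((biShift M).symm p) ∂m := by
    intro F hF
    have hkF : Continuous fun p => k p * F p := hk.mul hF
    have hkF' : Continuous fun p => k p * F ((biShift M).symm p) :=
      hk.mul (hF.comp continuous_biShift_symm)
    rw [hint, hint, integral_prod _ (integrable_of_continuous hkF),
      integral_prod_symm _ (integrable_of_continuous hkF')]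
    -- Invariance of `μ` inserts the operator of `B` in the variable `x`; after Fubini, `hexch`
    -- trades it for that of `B'` in `y`, which `ρ` absorbs.
    have h1 : ∀ y, ∫ x, k (y, x) * F (y, x) ∂μ =
        ∫ x, ruelleOp ν B (fun z => k (y, z) * F (y, z)) x ∂μ := fun y =>
      (hμ _ (hslice hkF y)).symm
    simp only [h1]
    rw [integral_integral_swap]
    · simp only [hexch hF]
    · refine integrable_of_continuous ?_
      exact continuous_integral_of_continuous (μ := ν)
        (f := fun (p : SymSeq M × SymSeq M) a => Real.exp (B (cons a p.2)) *
          (k (p.1, cons a p.2) * F (p.1, cons a p.2))) (hkx hkF)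
  have hmap : m.map (biShift M) = m := by
    have hmeas : Measurable (biShift M) := continuous_biShift.measurable
    have : IsProbabilityMeasure (m.map (biShift M)) :=
      Measure.isProbabilityMeasure_map hmeas.aemeasurable
    refine ext_of_forall_integral_eq_of_IsFiniteMeasure fun F => ?_
    have hFc : Continuous fun p => F (biShift M p) := F.continuous.comp continuous_biShift
    rw [integral_map hmeas.aemeasurable F.continuous.aestronglyMeasurable, hinv hFc]
    simp
  exact ⟨⟨hprob, hmap, hmapsnd⟩, hmapfst⟩

omit [MeasurableSpace M] [BorelSpace M] in
lemma IsLip₂.continuous {W : SymSeq M × SymSeq M → ℝ} (hW : IsLip₂ W) : Continuous W := by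
  obtain ⟨C, hC⟩ := hW
  refine continuous_iff_continuousAt.mpr fun q => ?_
  rw [ContinuousAt, tendsto_iff_dist_tendsto_zero]
  have h : Filter.Tendsto (fun p : SymSeq M × SymSeq M => C * (seqDist p.1 q.1 + seqDist p.2 q.2))
      (nhds q) (nhds 0) := by
    have h1 : Continuous fun p : SymSeq M × SymSeq M => seqDist p.1 q.1 :=
      continuous_seqDist.comp (continuous_fst.prodMk continuous_const)
    have h2 : Continuous fun p : SymSeq M × SymSeq M => seqDist p.2 q.2 :=
      continuous_seqDist.comp (continuous_snd.prodMk continuous_const)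
    have h3 : Continuous fun p : SymSeq M × SymSeq M =>
      C * (seqDist p.1 q.1 + seqDist p.2 q.2) := continuous_const.mul (h1.add h2)
    simpa using h3.tendsto q
  exact squeeze_zero (fun _ => dist_nonneg) (fun p => hC p q) h

variable {A : SymSeq M → ℝ} {W : SymSeq M × SymSeq M → ℝ} {Am : SymSeq M → ℝ}

omit [CompactSpace M] [MeasurableSpace M] [BorelSpace M] in
lemma IsInvolutionKernel.cons_eq (hW : IsInvolutionKernel A W Am) (a : M) (y x : SymSeq M) :
    Am (cons a y) + W (cons a y, x) = A (cons a x) + W (y, cons a x) := by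
  have := hW.2 (cons a y) x
  rw [show (biShift M).symm (cons a y, x) = (y, cons a x) from rfl] at this
  rw [this]
  ring

-- The defining formula is evaluated at one fixed `x`. In the constant, `A` contributes `C`, the
-- shifted copy of `W` contributes `3|D|` and `W` itself `|D|`.
omit [MeasurableSpace M] [BorelSpace M] in
lemma IsInvolutionKernel.isLip (hW : IsInvolutionKernel A W Am) (hA : IsLip A) [Nonempty M] :
    IsLip Am := by
  obtain ⟨C, hC0, hC⟩ := hA.exists_nonneg
  obtain ⟨⟨D, hD⟩, hAm⟩ := hW
  have hD' : ∀ p q, |W p - W q| ≤ |D| * (seqDist p.1 q.1 + seqDist p.2 q.2) := fun p q =>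
    (hD p q).trans (mul_le_mul_of_nonneg_right (le_abs_self D)
      (add_nonneg (seqDist_nonneg _ _) (seqDist_nonneg _ _)))
  let x : SymSeq M := fun _ => Classical.arbitrary M
  refine ⟨C + 4 * |D|, fun y y' => ?_⟩
  have h1 := seqDist_cons_le x x y y'
  have h2 := seqDist_shift_le y y'
  rw [seqDist_self, zero_div, add_zero] at h1
  have a1 := (hC (cons (y 0) x) (cons (y' 0) x)).trans (mul_le_mul_of_nonneg_left h1 hC0)
  have a2 := (hD' (shift y, cons (y 0) x) (shift y', cons (y' 0) x)).trans
    (mul_le_mul_of_nonneg_left (add_le_add h2 h1) (abs_nonneg D))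
  have a3 := hD' (y, x) (y', x)
  simp only [seqDist_self, add_zero] at a3
  rw [hAm y x, hAm y' x]
  change |A (cons (y 0) x) + W (shift y, cons (y 0) x) - W (y, x) -
    (A (cons (y' 0) x) + W (shift y', cons (y' 0) x) - W (y', x))| ≤ _
  rw [abs_le] at *
  constructor <;> linarith [a1.1, a1.2, a2.1, a2.2, a3.1, a3.2]

/-- The eigenfunction `∫ e^{W(y, x)} / h(x) dμ(x)` of the dual potential. -/
lemma IsInvolutionKernel.isEigenpair (hW : IsInvolutionKernel A W Am) (hA : IsLip A)
    {ev : ℝ} {h : SymSeq M → ℝ} (he : IsEigenpair ν A ev h) {μ : Measure (SymSeq M)}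
    [IsProbabilityMeasure μ] (hμ : IsFixed ν (normalizedPotential A h ev) μ) :
    IsEigenpair ν Am ev fun y => ∫ x, Real.exp (W (y, x)) / h x ∂μ := by
  have hAc := hA.continuous
  have hWc := hW.1.continuous
  have hk : Continuous fun p : SymSeq M × SymSeq M => Real.exp (W p) / h p.2 :=
    (Real.continuous_exp.comp hWc).div (he.continuous.comp continuous_snd) fun p => (he.pos _).ne'
  have hky : ∀ y, Continuous fun x => Real.exp (W (y, x)) / h x := fun y =>
    hk.comp (continuous_const.prodMk continuous_id)
  refine ⟨he.ev_pos, continuous_integral_of_continuous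
    (f := fun y x => Real.exp (W (y, x)) / h x) hk, fun y =>
    integral_pos_of_continuous (hky y) fun x => div_pos (Real.exp_pos _) (he.pos x), fun y => ?_⟩
  have hterm : ∀ a x, Real.exp (Am (cons a y)) * (Real.exp (W (cons a y, x)) / h x) =
      Real.exp (A (cons a x)) * Real.exp (W (y, cons a x)) / h x := fun a x => by
    rw [← mul_div_assoc, ← Real.exp_add, ← Real.exp_add, hW.cons_eq]
  have hc : Continuous fun q : M × SymSeq M =>
      Real.exp (A (cons q.1 q.2)) * Real.exp (W (y, cons q.1 q.2)) / h q.2 :=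
    ((Real.continuous_exp.comp (hAc.comp continuous_cons)).mul (Real.continuous_exp.comp
      (hWc.comp (continuous_const.prodMk continuous_cons)))).div
      (he.continuous.comp continuous_snd) fun q => (he.pos _).ne'
  -- After integration this says that `dμ / h` is an eigenmeasure of the dual operator of `A` with
  -- eigenvalue `ev`.
  have hL : ∀ x, ruelleOp ν A (fun z => Real.exp (W (y, z))) x / h x =
      ev * ruelleOp ν (normalizedPotential A h ev) (fun z => Real.exp (W (y, z)) / h z) x := by
    intro x
    rw [he.ruelleOp_normalizedPotential]
    have : (fun z => h z * (Real.exp (W (y, z)) / h z)) = fun z => Real.exp (W (y, z)) :=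
      funext fun z => mul_div_cancel₀ _ (he.pos z).ne'
    rw [this]
    have := he.ev_pos.ne'
    have := (he.pos x).ne'
    field_simp
  rw [ruelleOp]
  simp only [← integral_const_mul, hterm]
  rw [integral_integral_swap (f := fun a x => Real.exp (A (cons a x)) *
    Real.exp (W (y, cons a x)) / h x) (integrable_of_continuous hc)]
  simp only [integral_div]
  change ∫ x, ruelleOp ν A (fun z => Real.exp (W (y, z))) x / h x ∂μ = _
  simp only [hL, integral_const_mul]
  rw [hμ _ (hky y)]

end NaturalExtension

end TFCA

/-! ### The duality of equilibria. -/

theorem proposition6p5 {M : Type*} [MetricSpace M] [CompactSpace M]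
    [MeasurableSpace M] [BorelSpace M]
    (ν : Measure M) [IsProbabilityMeasure ν] [ν.IsOpenPosMeasure]
    (A : SymSeq M → ℝ) (hA : IsLip A)
    (W : SymSeq M × SymSeq M → ℝ) (Am : SymSeq M → ℝ) (hW : IsInvolutionKernel A W Am)
    (μ : Measure (SymSeq M)) (hμ : IsNuEquilibrium ν A μ) :
    (∃! μhat : Measure (SymSeq M × SymSeq M), IsInvariantExtension μ μhat) ∧
    ∀ μhat : Measure (SymSeq M × SymSeq M), IsInvariantExtension μ μhat →
      (IsNuEquilibrium ν Am (μhat.map Prod.fst) ∧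
        ∀ μ' : Measure (SymSeq M), IsNuEquilibrium ν Am μ' → μ' = μhat.map Prod.fst) ∧
      (AttainsPressure ν Am (μhat.map Prod.fst) ∧
        ∀ μ' : Measure (SymSeq M), AttainsPressure ν Am μ' → μ' = μhat.map Prod.fst) := by
  obtain ⟨hμp, ev, h, hev, hc, hpos, heig, hfix⟩ := hμ
  have he : IsEigenpair ν A ev h := ⟨hev, hc, hpos, heig⟩
  replace hfix : IsFixed ν (normalizedPotential A h ev) μ := hfix
  have : Nonempty M := nonempty_of_isProbabilityMeasure ν
  have hAm : IsLip Am := hW.isLip hA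
  have he' := hW.isEigenpair hA he hfix
  set h' : SymSeq M → ℝ := fun y => ∫ x, Real.exp (W (y, x)) / h x ∂μ with hh'
  have hB := he.isNormalized hA
  have hB' := he'.isNormalized hAm
  obtain ⟨ρ, hρp, hρ⟩ := hB'.exists_isFixed
  -- Dividing `e^W` by both eigenfunctions gives a kernel for the two normalized potentials; the
  -- factors `ev` cancel because both eigenvalues are equal.
  have hk : Continuous fun p : SymSeq M × SymSeq M => Real.exp (W p) / h p.2 / h' p.1 :=
    ((Real.continuous_exp.comp hW.1.continuous).div (hc.comp continuous_snd)
      fun p => (hpos _).ne').div (he'.continuous.comp continuous_fst) fun p => (he'.pos _).ne'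
  obtain ⟨hext, hfst⟩ := isInvariantExtension_withDensity hB hfix hρ hk
    (fun p => div_pos (div_pos (Real.exp_pos _) (hpos _)) (he'.pos _))
    (fun a y x => by
      have e1 := hW.cons_eq a y x
      have p1 := (hpos x).ne'
      have p2 := (hpos (cons a x)).ne'
      have p3 := (he'.pos y).ne'
      have p4 := (he'.pos (cons a y)).ne'
      simp only [normalizedPotential, shift_cons, Real.exp_sub, Real.exp_add,
        Real.exp_log (hpos _), Real.exp_log (he'.pos _), Real.exp_log hev]
      have e2 : Real.exp (Am (cons a y)) * Real.exp (W (cons a y, x)) =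
          Real.exp (A (cons a x)) * Real.exp (W (y, cons a x)) := by
        rw [← Real.exp_add, ← Real.exp_add, e1]
      have p5 := hev.ne'
      calc _ = Real.exp (Am (cons a y)) * Real.exp (W (cons a y, x)) / (ev * h x * h' y) := by
            field_simp
        _ = _ := by rw [e2]; field_simp)
    (fun y => by
      simp only [integral_div]
      exact div_self (he'.pos y).ne')
  have hfixed_iff : ∀ μ' : Measure (SymSeq M),
      IsProbabilityMeasure μ' ∧ IsFixed ν (normalizedPotential Am h' ev) μ' → μ' = ρ :=
    fun μ' ⟨hp, hf⟩ => hB'.isFixed_unique hf hρ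
  refine ⟨⟨_, hext, fun m hm => hm.unique hext⟩, fun m hm => ?_⟩
  rw [hm.unique hext, hfst]
  exact ⟨⟨(he'.isNuEquilibrium_iff hAm).mpr ⟨hρp, hρ⟩, fun μ' hμ' =>
    hfixed_iff μ' ((he'.isNuEquilibrium_iff hAm).mp hμ')⟩,
    (he'.attainsPressure_iff hAm).mpr ⟨hρp, hρ⟩, fun μ' hμ' =>
    hfixed_iff μ' ((he'.attainsPressure_iff hAm).mp hμ')⟩
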